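/- Let $n\ge 3$ be an integer and let $G$ be a finitely generated torsion-free nilpotent group of cohomological dimension $k<n$; that is, $H^i(G;A)=0$ for every $i>k$ and every $\mathbb{Z}G$-module $A$, while $H^k(G;M)\neq 0$ for some $\mathbb{Z}G$-module $M$. Let $\mathrm{Out}(G)=\mathrm{Aut}(G)/\mathrm{Inn}(G)$ be the outer automorphism group of $G$, and let $\mathrm{St}_n(\mathbb{Z})$ be the Steinberg group, that is, the group generated by symbols $x_{ij}(r)$ ($1\le i\neq j\le n$, $r\in\mathbb{Z}$) subject to the relations \begin{enumerate} \item $x_{ij}(r)\,x_{ij}(s)=x_{ij}(r+s)$; \item $[x_{ij}(r),x_{jk}(s)]=x_{ik}(rs)$ if $i\neq k$; \item $[x_{ij}(r),x_{pq}(s)]=1$ if $j\neq p$ and $i\neq q$, \end{enumerate} where $[a,b]=aba^{-1}b^{-1}$. Then every group homomorphism $\mathrm{St}_n(\mathbb{Z})\to\mathrm{Out}(G)$ is trivial, and hence every group homomorphism $\mathrm{SL}_n(\mathbb{Z})\to\mathrm{Out}(G)$ is trivial. -/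

import Mathlib

universe u v

/-- The symbol `x_{ij}(r)`, for `i ≠ j`, in the free group on all such symbols. -/
abbrev steinbergGen {n : ℕ} {R : Type v} (i j : Fin n) (hij : i ≠ j) (r : R) :
    FreeGroup ({p : Fin n × Fin n // p.1 ≠ p.2} × R) :=
  FreeGroup.of (⟨(i, j), hij⟩, r)

/-- The relators of the Steinberg group `St_n(R)`, in the free group on the symbols `x_{ij}(r)` with
`i ≠ j` and `r ∈ R`. Commutators are `[a, b] = a b a⁻¹ b⁻¹`. -/
inductive SteinbergRel (n : ℕ) (R : Type v) [Ring R] :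
    FreeGroup ({p : Fin n × Fin n // p.1 ≠ p.2} × R) → Prop
  /-- `x_{ij}(r) x_{ij}(s) = x_{ij}(r + s)` -/
  | add (i j : Fin n) (hij : i ≠ j) (r s : R) :
      SteinbergRel n R
        (steinbergGen i j hij r * steinbergGen i j hij s * (steinbergGen i j hij (r + s))⁻¹)
  /-- `[x_{ij}(r), x_{jk}(s)] = x_{ik}(r s)` for `i ≠ k` -/
  | comm_mul (i j k : Fin n) (hij : i ≠ j) (hjk : j ≠ k) (hik : i ≠ k) (r s : R) :
      SteinbergRel n R
        (steinbergGen i j hij r * steinbergGen j k hjk s *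
          (steinbergGen i j hij r)⁻¹ * (steinbergGen j k hjk s)⁻¹ * (steinbergGen i k hik (r * s))⁻¹)
  /-- `[x_{ij}(r), x_{pq}(s)] = 1` for `j ≠ p` and `i ≠ q` -/
  | comm_one (i j p q : Fin n) (hij : i ≠ j) (hpq : p ≠ q) (hjp : j ≠ p) (hiq : i ≠ q) (r s : R) :
      SteinbergRel n R
        (steinbergGen i j hij r * steinbergGen p q hpq s *
          (steinbergGen i j hij r)⁻¹ * (steinbergGen p q hpq s)⁻¹)

/-- The Steinberg group `St_n(R)`. -/
abbrev SteinbergGroup (n : ℕ) (R : Type v) [Ring R] : Type v :=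
  PresentedGroup {w | SteinbergRel n R w}

/-- The subgroup `Inn(G)` of inner automorphisms. -/
abbrev innerAut (G : Type u) [Group G] : Subgroup (MulAut G) :=
  (MulAut.conj : G →* MulAut G).range

instance innerAut_normal (G : Type u) [Group G] : (innerAut G).Normal where
  conj_mem := by
    rintro _ ⟨g, rfl⟩ φ
    exact ⟨φ g, by ext x; simp [MulAut.conj_apply]⟩

/-- The outer automorphism group `Out(G) = Aut(G) / Inn(G)`. -/
abbrev OuterAut (G : Type u) [Group G] : Type u :=
  MulAut G ⧸ innerAut G

/-- `G` has cohomological dimension `k`: `H^i(G; A) = 0` for all `i > k` and all `ℤG`-modules `A`,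
and `H^k(G; M) ≠ 0` for some `ℤG`-module `M`. The ring of integers is lifted to the universe of `G`
because group cohomology is defined for a coefficient ring in that universe. -/
def HasCohomologicalDimension (G : Type u) [Group G] (k : ℕ) : Prop :=
  (∀ (A : Rep.{u} (ULift.{u} ℤ) G) (i : ℕ), k < i →
      CategoryTheory.Limits.IsZero (groupCohomology A i)) ∧
    ∃ M : Rep.{u} (ULift.{u} ℤ) G, ¬ CategoryTheory.Limits.IsZero (groupCohomology M k)

/-!
Let `h` be the Hirsch length of `G`.

If `z` is a central element of infinite order, then `z - 1` acts injectively on the group ring of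
`G`, with cokernel the group ring of `G ⧸ ⟨z⟩`, and as zero on modules over the latter. Rees' change
of rings therefore shifts a nonzero `Ext` group with values in the group ring of `G ⧸ ⟨z⟩` to a
nonzero one for `G`, one degree higher. Along the upper central series this yields `H^h(G; KG) ≠ 0`,
so `h` is at most the cohomological dimension, hence `h < n`.

A representation of `St_n(R)` of dimension less than `n` is trivial. The elements `x_{a1}(1), …,
x_{an}(1)` commute, and `x_{ij}(1)` turns a common eigenvector with eigenvalues `χ` into one whose
`i`-th eigenvalue is `χ i * χ j`. A nontrivial eigenvalue would thus produce `n` distinct eigenvalue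
functions, so all the `x_{ij}(1)` are unipotent. Induction on the dimension then applies to the
vectors fixed by a row and to the quotient by them.

Hence `St_n(R)` acts trivially on `Z(G)`, which is free of rank at most `h`, and by induction its
image in `Out(G ⧸ Z(G))` is trivial. The kernel of `Out(G) → Out(G ⧸ Z(G)) × Aut(Z(G))` is abelian,
whereas `St_n(R)` is perfect. Over a Euclidean domain, Gaussian elimination makes `SL_n(R)` a
quotient of `St_n(R)`.
-/

section Center

variable {G : Type*} [Group G]

theorem normal_of_le_center {N : Subgroup G} (hN : N ≤ Subgroup.center G) : N.Normal where
  conj_mem n hn g := by rwa [Subgroup.mem_center_iff.1 (hN hn) g, mul_inv_cancel_right]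

theorem map_mem_center {H : Type*} [Group H] {f : G →* H} (hf : Function.Surjective f) {z : G}
    (hz : z ∈ Subgroup.center G) : f z ∈ Subgroup.center H := by
  refine Subgroup.mem_center_iff.2 (hf.forall.2 fun g => ?_)
  rw [← map_mul, ← map_mul, Subgroup.mem_center_iff.1 hz g]

end Center

section Rees

open CategoryTheory Limits

variable {C : Type*} [Category* C] [Abelian C]

theorem hom_eq_zero_of_app_eq_zero (θ : 𝟭 C ⟶ 𝟭 C) {X Y : C} [Mono (θ.app Y)]
    (hX : θ.app X = 0) (f : X ⟶ Y) : f = 0 := by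
  have naturality : f ≫ θ.app Y = θ.app X ≫ f := θ.naturality f
  rw [← cancel_mono (θ.app Y), naturality, hX, zero_comp, zero_comp]

variable [HasExt.{v} C]

theorem subsingleton_ext_X₁ {S : ShortComplex C} (hS : S.ShortExact) {Y : C} {n : ℕ}
    (h₂ : Subsingleton (Abelian.Ext.{v} S.X₂ Y n))
    (h₃ : Subsingleton (Abelian.Ext.{v} S.X₃ Y (n + 1))) :
    Subsingleton (Abelian.Ext.{v} S.X₁ Y n) := by
  refine subsingleton_of_forall_eq 0 fun a => ?_
  obtain ⟨x, rfl⟩ := Abelian.Ext.contravariant_sequence_exact₁ hS Y a (add_comm 1 n)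
    (Subsingleton.elim _ _)
  rw [Subsingleton.elim x 0, Abelian.Ext.comp_zero]

theorem subsingleton_ext_X₃ {S : ShortComplex C} (hS : S.ShortExact) {Y : C} {n : ℕ}
    (h₁ : Subsingleton (Abelian.Ext.{v} S.X₁ Y n))
    (h₂ : Subsingleton (Abelian.Ext.{v} S.X₂ Y (n + 1))) :
    Subsingleton (Abelian.Ext.{v} S.X₃ Y (n + 1)) := by
  refine subsingleton_of_forall_eq 0 fun a => ?_
  obtain ⟨x, rfl⟩ := Abelian.Ext.contravariant_sequence_exact₃ hS Y a (Subsingleton.elim _ _)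
    (add_comm 1 n)
  rw [Subsingleton.elim x 0, Abelian.Ext.comp_zero]

theorem eq_zero_of_mk₀_comp_extClass_eq_zero {S : ShortComplex C} (hS : S.ShortExact) {X : C}
    (hX : ∀ g : X ⟶ S.X₂, g = 0) {f : X ⟶ S.X₃}
    (hf : (Abelian.Ext.mk₀ f).comp hS.extClass (zero_add 1) = 0) : f = 0 := by
  obtain ⟨x, hx⟩ :=
    Abelian.Ext.covariant_sequence_exact₃ _ hS (Abelian.Ext.mk₀ f) (zero_add 1) hf
  obtain ⟨g, rfl⟩ := (Abelian.Ext.mk₀_bijective _ _).2 x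
  rw [hX g, Abelian.Ext.mk₀_comp_mk₀, zero_comp] at hx
  exact ((Abelian.Ext.mk₀_bijective _ _).1 hx).symm

/-- On the kernel `ι : K ⟶ P` of a projective presentation of `M`, the endomorphism `θ` factors
through `ι`, and `Ext¹(M, Y)` is the cokernel of `Hom(P, Y) → Hom(K, Y)`. -/
theorem ext_one_comp_app_eq_zero [EnoughProjectives C] (θ : 𝟭 C ⟶ 𝟭 C) {M : C}
    (hM : θ.app M = 0) (Y : C) (α : Abelian.Ext.{v} M Y 1) :
    α.comp (Abelian.Ext.mk₀ (θ.app Y)) (add_zero 1) = 0 := by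
  obtain ⟨P⟩ := EnoughProjectives.presentation M
  have := P.projective
  let S := ShortComplex.mk _ _ (kernel.condition P.f)
  have hS : S.ShortExact := { exact := ShortComplex.exact_kernel P.f }
  have : Mono S.f := hS.mono_f
  have : Subsingleton (Abelian.Ext.{v} S.X₂ Y 1) := Abelian.Ext.subsingleton_of_projective _ _ 0
  obtain ⟨β, rfl⟩ :=
    Abelian.Ext.contravariant_sequence_exact₃ hS Y α (Subsingleton.elim _ _) (add_zero 1)
  obtain ⟨f, rfl⟩ := (Abelian.Ext.mk₀_bijective _ _).2 β
  have app_comp : θ.app P.p ≫ P.f = 0 := by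
    have naturality : P.f ≫ θ.app M = θ.app P.p ≫ P.f := θ.naturality P.f
    rw [← naturality, hM, comp_zero]
  let w : P.p ⟶ S.X₁ := kernel.lift P.f (θ.app P.p) app_comp
  have factorization : S.f ≫ w = θ.app S.X₁ := by
    have lift_comp : w ≫ S.f = θ.app P.p := kernel.lift_ι _ _ _
    rw [← cancel_mono S.f, Category.assoc, lift_comp]
    exact θ.naturality S.f
  have comp_app : f ≫ θ.app Y = S.f ≫ w ≫ f := by
    rw [← Category.assoc, factorization]
    exact θ.naturality f
  rw [Abelian.Ext.comp_assoc _ _ _ (by simp) (add_zero 0) (by simp), Abelian.Ext.mk₀_comp_mk₀,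
    comp_app, ← Abelian.Ext.mk₀_comp_mk₀ S.f,
    ← Abelian.Ext.comp_assoc _ _ _ (add_zero 1) (add_zero 0) (by simp), hS.extClass_comp,
    Abelian.Ext.zero_comp]

variable {D : Type*} [Category* D] [Abelian D] [HasExt.{v} D]
  (F : D ⥤ C) [F.Additive] [F.Faithful] (θ : 𝟭 C ⟶ 𝟭 C)
  {Y : C} {Y' : D} {q : Y ⟶ F.obj Y'} {w : θ.app Y ≫ q = 0}

theorem subsingleton_ext_zero_of_subsingleton_ext_one
    (hS : (ShortComplex.mk (θ.app Y) q w).ShortExact) {M : D} (hM : θ.app (F.obj M) = 0)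
    (h : Subsingleton (Abelian.Ext.{v} (F.obj M) Y 1)) :
    Subsingleton (Abelian.Ext.{v} M Y' 0) := by
  have : Mono (θ.app Y) := hS.mono_f
  refine subsingleton_of_forall_eq 0 fun a => ?_
  obtain ⟨f, rfl⟩ := (Abelian.Ext.mk₀_bijective _ _).2 a
  have hom_eq_zero : ∀ g : F.obj M ⟶ Y, g = 0 := hom_eq_zero_of_app_eq_zero θ hM
  have map_eq_zero : F.map f = 0 :=
    eq_zero_of_mk₀_comp_extClass_eq_zero hS hom_eq_zero (@Subsingleton.elim _ h _ _)
  rw [F.map_injective (map_eq_zero.trans (F.map_zero _ _).symm), Abelian.Ext.mk₀_zero]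

variable [EnoughProjectives C] [F.Full] [PreservesFiniteLimits F] [PreservesFiniteColimits F]

/-- A map `K ⟶ Y'` gives a class in `Ext¹(F K, Y)`, which extends to a class in `Ext¹(F P, Y)`; that
class is killed by `θ`, hence comes from a map `F P ⟶ F Y'`, and `F` is full. -/
theorem subsingleton_ext_one_of_subsingleton_ext_two (hθ : ∀ M : D, θ.app (F.obj M) = 0)
    (hS : (ShortComplex.mk (θ.app Y) q w).ShortExact) {T : ShortComplex D} (hT : T.ShortExact)
    [Projective T.X₂] (h : Subsingleton (Abelian.Ext.{v} (F.obj T.X₃) Y 2)) :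
    Subsingleton (Abelian.Ext.{v} T.X₃ Y' 1) := by
  have : Mono (θ.app Y) := hS.mono_f
  have : Subsingleton (Abelian.Ext.{v} T.X₂ Y' 1) := Abelian.Ext.subsingleton_of_projective _ _ 0
  refine subsingleton_of_forall_eq 0 fun a => ?_
  obtain ⟨β, rfl⟩ := Abelian.Ext.contravariant_sequence_exact₃ hT Y' (n₀ := 0) a
    (Subsingleton.elim _ _) (add_zero 1)
  obtain ⟨f, rfl⟩ := (Abelian.Ext.mk₀_bijective _ _).2 β
  obtain ⟨δ, hδ⟩ := Abelian.Ext.contravariant_sequence_exact₁ (hT.map_of_exact F) Y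
    ((Abelian.Ext.mk₀ (F.map f)).comp hS.extClass (zero_add 1)) (n₁ := 2) rfl
    (@Subsingleton.elim _ h _ _)
  obtain ⟨ε, hε⟩ := Abelian.Ext.covariant_sequence_exact₁ _ hS δ
    (ext_one_comp_app_eq_zero θ (hθ T.X₂) Y δ) (zero_add 1)
  obtain ⟨g', rfl⟩ := (Abelian.Ext.mk₀_bijective _ _).2 ε
  obtain ⟨g, rfl⟩ := F.map_surjective g'
  have map_eq : F.map f = F.map (T.f ≫ g) := by
    rw [← sub_eq_zero]
    have hom_eq_zero : ∀ g : F.obj T.X₁ ⟶ Y, g = 0 := hom_eq_zero_of_app_eq_zero θ (hθ _)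
    refine eq_zero_of_mk₀_comp_extClass_eq_zero hS hom_eq_zero ?_
    rw [sub_eq_add_neg, Abelian.Ext.mk₀_add, Abelian.Ext.mk₀_neg, Abelian.Ext.add_comp,
      Abelian.Ext.neg_comp, ← sub_eq_add_neg, sub_eq_zero, F.map_comp,
      ← Abelian.Ext.mk₀_comp_mk₀, Abelian.Ext.comp_assoc _ _ _ (add_zero 0) (zero_add 1) (by simp)]
    exact hδ.symm.trans (by rw [← hε]; rfl)
  rw [F.map_injective map_eq, ← Abelian.Ext.mk₀_comp_mk₀,
    ← Abelian.Ext.comp_assoc _ _ _ (add_zero 1) (add_zero 0) (by simp), hT.extClass_comp,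
    Abelian.Ext.zero_comp]

/-- This is Rees' change of rings isomorphism `Ext^i(M, Y') ≅ Ext^{i+1}(F M, Y)`, as a vanishing
statement. -/
theorem subsingleton_ext_of_subsingleton_ext_succ (hθ : ∀ M : D, θ.app (F.obj M) = 0)
    (hP : ∀ M : D, ∃ (P : D) (p : P ⟶ M), Projective P ∧ Epi p ∧
      HasProjectiveDimensionLT (F.obj P) 2)
    (hS : (ShortComplex.mk (θ.app Y) q w).ShortExact) (i : ℕ) (M : D)
    (h : Subsingleton (Abelian.Ext.{v} (F.obj M) Y (i + 1))) :
    Subsingleton (Abelian.Ext.{v} M Y' i) := by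
  induction i generalizing M with
  | zero => exact subsingleton_ext_zero_of_subsingleton_ext_one F θ hS (hθ M) h
  | succ i ih =>
    obtain ⟨P, p, _, _, _⟩ := hP M
    let T := ShortComplex.mk _ _ (kernel.condition p)
    have hT : T.ShortExact := { exact := ShortComplex.exact_kernel p }
    cases i with
    | zero => exact subsingleton_ext_one_of_subsingleton_ext_two F θ hθ hS hT h
    | succ i =>
      have : Subsingleton (Abelian.Ext.{v} (F.obj P) Y (i + 2)) :=
        HasProjectiveDimensionLT.subsingleton _ 2 _ (by omega) _
      have : Subsingleton (Abelian.Ext.{v} T.X₁ Y' (i + 1)) :=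
        ih _ (subsingleton_ext_X₁ (hT.map_of_exact F) this h)
      exact subsingleton_ext_X₃ hT this (Abelian.Ext.subsingleton_of_projective _ _ _)

end Rees

section GroupRing

open CategoryTheory Limits

theorem exact_finsuppMapRange {α R M N P : Type*} [Semiring R] [AddCommMonoid M] [AddCommMonoid N]
    [AddCommMonoid P] [Module R M] [Module R N] [Module R P] {f : M →ₗ[R] N} {g : N →ₗ[R] P}
    (h : Function.Exact f g) :
    Function.Exact (Finsupp.mapRange.linearMap (α := α) f) (Finsupp.mapRange.linearMap g) := by
  intro x
  have mem_range : x ∈ Set.range (Finsupp.mapRange f f.map_zero) ↔ ∀ a, x a ∈ Set.range f := by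
    rw [Finsupp.range_mapRange, Set.mem_ofPred_eq]
  exact (Finsupp.ext_iff.trans (forall_congr' fun a => h (x a))).trans mem_range.symm

variable {K G Q : Type u} [CommRing K] [Group G] [Group Q]

instance hasExtRep (K G : Type u) [CommRing K] [Group G] : HasExt.{u} (Rep.{u} K G) :=
  hasExt_of_enoughProjectives.{u} _

/-- Left multiplication by `z - 1` on the group algebra of `G`; for central `z`, its cokernel is the
group algebra of `G ⧸ ⟨z⟩`. -/
noncomputable def mulSubOne (K : Type u) [CommRing K] (z : G) :
    MonoidAlgebra K G →ₗ[K] MonoidAlgebra K G :=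
  Representation.leftRegular K G z - LinearMap.id

theorem mulSubOne_single (z g : G) (r : K) :
    mulSubOne K z (.single g r) = .single (z * g) r - .single g r := by
  simp [mulSubOne]

theorem mulSubOne_injective {z : G} (hz : ¬ IsOfFinOrder z) :
    Function.Injective (mulSubOne K z) := by
  rw [injective_iff_map_eq_zero]
  intro x hx
  have smul_eq : Representation.leftRegular K G z x = x := by
    simpa [sub_eq_zero, mulSubOne] using hx
  have coeff_mul (g : G) : x.coeff (z * g) = x.coeff g := by
    conv_lhs => rw [← smul_eq]
    simp
  have coeff_pow_mul (n : ℕ) (g : G) : x.coeff (z ^ n * g) = x.coeff g := by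
    induction n with
    | zero => rw [pow_zero, one_mul]
    | succ n ih => rw [pow_succ', mul_assoc, coeff_mul, ih]
  ext g
  by_contra hg
  have pow_mul_injective : Function.Injective fun n : ℕ => z ^ n * g := fun a b h =>
    injective_pow_iff_not_isOfFinOrder.2 hz (mul_right_cancel h)
  refine Set.infinite_range_of_injective pow_mul_injective
    (x.coeff.support.finite_toSet.subset ?_)
  rintro _ ⟨n, rfl⟩
  simpa [coeff_pow_mul] using hg

theorem single_sub_single_mem_range_mulSubOne {z g h : G} (hgh : g * h⁻¹ ∈ Subgroup.zpowers z)
    (r : K) : MonoidAlgebra.single g r - .single h r ∈ (mulSubOne K z).range := by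
  obtain ⟨n, hn⟩ := Subgroup.mem_zpowers_iff.1 hgh
  obtain rfl : g = z ^ n * h := by rw [hn, inv_mul_cancel_right]
  clear hgh hn
  have zpow_add_one_sub (m : ℤ) : MonoidAlgebra.single (z ^ (m + 1) * h) r -
      MonoidAlgebra.single (z ^ m * h) r ∈ (mulSubOne K z).range :=
    ⟨.single (z ^ m * h) r, by rw [mulSubOne_single, add_comm m, zpow_one_add, mul_assoc]⟩
  induction n with
  | zero => simp
  | succ n ih => simpa using add_mem (zpow_add_one_sub n) ih
  | pred n ih => simpa using sub_mem ih (zpow_add_one_sub (-n - 1))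

theorem exact_mulSubOne {π : G →* Q} (hπ : Function.Surjective π) {z : G}
    (hker : π.ker = Subgroup.zpowers z) :
    Function.Exact (mulSubOne K z) (MonoidAlgebra.mapDomainAlgHom K K π).toLinearMap := by
  have map_z : π z = 1 := π.mem_ker.1 (hker ▸ Subgroup.mem_zpowers z)
  have sub_section_mem (y : MonoidAlgebra K G) :
      y - .mapDomain (Function.surjInv hπ) (.mapDomain π y) ∈ (mulSubOne K z).range := by
    induction y using MonoidAlgebra.induction_linear with
    | zero => simp
    | add f g hf hg =>
      simpa only [MonoidAlgebra.mapDomain_add, add_sub_add_comm] using add_mem hf hg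
    | single g r =>
      rw [MonoidAlgebra.mapDomain_single, MonoidAlgebra.mapDomain_single]
      refine single_sub_single_mem_range_mulSubOne ?_ r
      rw [← hker, MonoidHom.mem_ker, map_mul, map_inv, Function.surjInv_eq hπ, mul_inv_cancel]
  intro x
  constructor
  · intro hx
    have map_x : MonoidAlgebra.mapDomain π x = 0 := hx
    have mem_range := sub_section_mem x
    rwa [map_x, MonoidAlgebra.mapDomain_zero, sub_zero] at mem_range
  · rintro ⟨y, rfl⟩
    induction y using MonoidAlgebra.induction_linear with
    | zero => rw [map_zero, map_zero]
    | add f g hf hg => rw [map_add, map_add, hf, hg, add_zero]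
    | single g r => rw [mulSubOne_single, map_sub, sub_eq_zero]; simp [map_z]

/-- The natural transformation `ρ(z) - 1` of representations, for a central element `z`. It vanishes
on representations of `G ⧸ ⟨z⟩`. -/
def centralSubOne (K : Type u) [CommRing K] {z : G} (hz : z ∈ Subgroup.center G) :
    𝟭 (Rep.{u} K G) ⟶ 𝟭 (Rep.{u} K G) where
  app A := Rep.ofHom ⟨A.ρ z - 1, fun g => by
    have comm : A.ρ g * A.ρ z = A.ρ z * A.ρ g := by
      rw [← map_mul, Subgroup.mem_center_iff.1 hz g, map_mul]
    change (A.ρ z - 1) * A.ρ g = A.ρ g * (A.ρ z - 1)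
    rw [sub_mul, mul_sub, comm, one_mul, mul_one]⟩
  naturality A B f := by
    ext x
    simp [Rep.hom_comm_apply]

theorem centralSubOne_app_res (π : G →* Q) {z : G} (hz : z ∈ Subgroup.center G) (hπz : π z = 1)
    (A : Rep.{u} K Q) : (centralSubOne K hz).app ((Rep.resFunctor π).obj A) = 0 := by
  refine Rep.hom_ext (Representation.IntertwiningMap.ext ?_)
  change A.ρ (π z) - 1 = 0
  rw [hπz, map_one, sub_self]

/-- The projection of free representations induced by a group homomorphism. For `G → G ⧸ ⟨z⟩` it is
the cokernel of `centralSubOne`. -/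
noncomputable def freeRepMap (K : Type u) [CommRing K] (π : G →* Q) (α : Type u) :
    Rep.free K G α ⟶ (Rep.resFunctor π).obj (Rep.free K Q α) :=
  Rep.ofHom ⟨Finsupp.mapRange.linearMap (MonoidAlgebra.mapDomainAlgHom K K π).toLinearMap,
    fun g => by
      ext a h : 3
      simp⟩

theorem centralSubOne_app_free_hom {z : G} (hz : z ∈ Subgroup.center G) (α : Type u) :
    ((centralSubOne K hz).app (Rep.free K G α)).hom.toLinearMap =
      Finsupp.mapRange.linearMap (mulSubOne K z) := by
  refine Finsupp.lhom_ext fun a y => ?_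
  change Representation.free K G α z (Finsupp.single a y) - Finsupp.single a y = _
  rw [Finsupp.mapRange.linearMap_apply, Finsupp.mapRange_single, Representation.finsupp_single,
    ← Finsupp.single_sub]
  rfl

theorem exists_shortExact_centralSubOne_freeRepMap {π : G →* Q} (hπ : Function.Surjective π) {z : G}
    (hz : z ∈ Subgroup.center G) (hz' : ¬ IsOfFinOrder z) (hker : π.ker = Subgroup.zpowers z)
    (α : Type u) :
    ∃ w : (centralSubOne K hz).app (Rep.free K G α) ≫ freeRepMap K π α = 0,
      (ShortComplex.mk ((centralSubOne K hz).app (Rep.free K G α)) (freeRepMap K π α)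
        w).ShortExact := by
  have app_hom := centralSubOne_app_free_hom (K := K) hz α
  have injective : Function.Injective ((centralSubOne K hz).app (Rep.free K G α)).hom := by
    change Function.Injective ((centralSubOne K hz).app (Rep.free K G α)).hom.toLinearMap
    rw [app_hom]
    exact Finsupp.mapRange_injective _ (map_zero _) (mulSubOne_injective hz')
  have surjective : Function.Surjective (freeRepMap K π α).hom :=
    Finsupp.mapRange_surjective _ (map_zero _) fun y =>
      (Finsupp.mapDomain_surjective hπ y.coeff).imp' .ofCoeff fun _ =>
        congrArg MonoidAlgebra.ofCoeff
  have exact : Function.Exact ((centralSubOne K hz).app (Rep.free K G α)).hom.toLinearMap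
      (freeRepMap K π α).hom.toLinearMap := by
    rw [app_hom]
    exact exact_finsuppMapRange (exact_mulSubOne hπ hker)
  have w : (centralSubOne K hz).app (Rep.free K G α) ≫ freeRepMap K π α = 0 :=
    Rep.hom_ext (Representation.IntertwiningMap.ext exact.linearMap_comp_eq_zero)
  have : Mono ((centralSubOne K hz).app (Rep.free K G α)) := (Rep.mono_iff_injective _).2 injective
  have : Epi (freeRepMap K π α) := (Rep.epi_iff_surjective _).2 surjective
  refine ⟨w, ShortComplex.ShortExact.mk ?_⟩
  rw [← ShortComplex.exact_map_iff_of_faithful _ (forget₂ (Rep.{u} K G) (ModuleCat.{u} K)),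
    ShortComplex.ShortExact.moduleCat_exact_iff_function_exact]
  exact exact

end GroupRing

section RegularExt

open CategoryTheory Limits
open scoped IsMulCommutative

variable {K G Q : Type u} [CommRing K] [Group G] [Group Q]

theorem subsingleton_ext_of_isZero_groupCohomology {A : Rep.{u} K G} {n : ℕ}
    (h : IsZero (groupCohomology A (n + 1))) :
    Subsingleton (Abelian.Ext.{u} (Rep.trivial K G K) A (n + 1)) := by
  let P := Rep.standardResolution K G
  have exact : IsZero ((P.complex.linearYonedaObj K A).homology (n + 1)) :=
    h.of_iso (groupCohomologyIso A (n + 1) P).symm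
  rw [← HomologicalComplex.exactAt_iff_isZero_homology,
    HomologicalComplex.exactAt_iff' _ n (n + 1) (n + 2) (by simp) (by simp),
    ShortComplex.moduleCat_exact_iff] at exact
  refine subsingleton_of_forall_eq 0 fun a => ?_
  obtain ⟨f, hf, rfl⟩ := P.extMk_surjective a (n + 2) rfl
  rw [P.extMk_eq_zero_iff _ _ _ _ n rfl]
  exact exact f hf

theorem eq_zero_of_zpow_mem_closure {A σ : Type*} [CommGroup A] {z : σ → A}
    (hz : LinearIndependent ℤ fun j => Additive.ofMul (z j)) {j : σ} {s : Set σ} (hj : j ∉ s)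
    {k : ℤ} (hk : z j ^ k ∈ Subgroup.closure (z '' s)) : k = 0 := by
  have smul_mem : k • Additive.ofMul (z j) ∈
      Submodule.span ℤ ((fun j => Additive.ofMul (z j)) '' s) := by
    rw [← Submodule.mem_toAddSubgroup, Submodule.span_int_eq_addSubgroupClosure]
    have mem : Additive.ofMul (z j ^ k) ∈ Subgroup.toAddSubgroup (Subgroup.closure (z '' s)) := hk
    rwa [Subgroup.toAddSubgroup_closure] at mem
  refine linearIndependent_iff_eq_zero_of_smul_mem_span.1 hz j k (Submodule.span_mono ?_ smul_mem)
  exact Set.image_mono fun i hi => ⟨trivial, ne_of_mem_of_not_mem hi hj⟩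

/-- The property that `Ext^i_{KG}(K, KG)` is nonzero. A torsion-free nilpotent group has it for `i`
its Hirsch length, which is how the cohomological dimension bounds the Hirsch length. -/
def RegularExtNontrivial (K G : Type u) [CommRing K] [Group G] (i : ℕ) : Prop :=
  Nontrivial (Abelian.Ext.{u} (Rep.trivial K G K) (Rep.free K G PUnit.{u + 1}) i)

namespace RegularExtNontrivial

theorem lt_of_isZero_groupCohomology {h n : ℕ} (hG : RegularExtNontrivial K G h) (hn : 0 < n)
    (hzero : ∀ i, n ≤ i → IsZero (groupCohomology (Rep.free K G PUnit.{u + 1}) i)) : h < n := by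
  by_contra! hle
  obtain ⟨i, rfl⟩ := Nat.exists_eq_add_one_of_ne_zero (hn.trans_le hle).ne'
  exact not_nontrivial_iff_subsingleton.2
    (subsingleton_ext_of_isZero_groupCohomology (hzero _ hle)) hG

theorem zero_of_subsingleton [Nontrivial K] [Subsingleton G] : RegularExtNontrivial K G 0 := by
  let f : Rep.trivial K G K ⟶ Rep.free K G PUnit.{u + 1} :=
    Rep.ofHom ⟨(Finsupp.lsingle PUnit.unit).comp (Algebra.linearMap K (MonoidAlgebra K G)),
      fun g => by
        obtain rfl : g = 1 := Subsingleton.elim _ _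
        ext
        simp⟩
  have f_ne_zero : f ≠ 0 := by
    intro hf
    have f_one : Finsupp.single PUnit.unit (algebraMap K (MonoidAlgebra K G) 1) = 0 :=
      congrArg (fun t : Rep.trivial K G K ⟶ Rep.free K G PUnit.{u + 1} => t.hom (1 : K)) hf
    rw [Finsupp.single_eq_zero, map_one] at f_one
    exact one_ne_zero f_one
  exact ⟨Abelian.Ext.mk₀ f, 0, fun h =>
    f_ne_zero ((Abelian.Ext.mk₀_bijective _ _).1 (h.trans (Abelian.Ext.mk₀_zero _ _).symm))⟩

theorem of_ker_eq_zpowers {i : ℕ} (h : RegularExtNontrivial K Q i) {π : G →* Q}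
    (hπ : Function.Surjective π) {z : G} (hz : z ∈ Subgroup.center G) (hz' : ¬ IsOfFinOrder z)
    (hker : π.ker = Subgroup.zpowers z) : RegularExtNontrivial K G (i + 1) := by
  have map_z : π z = 1 := π.mem_ker.1 (hker ▸ Subgroup.mem_zpowers z)
  have := Rep.full_res (k := K) π hπ
  obtain ⟨w, hw⟩ := exists_shortExact_centralSubOne_freeRepMap (K := K) hπ hz hz' hker PUnit.{u + 1}
  have exists_projective_cover (M : Rep.{u} K Q) : ∃ (P : Rep.{u} K Q) (p : P ⟶ M),
      Projective P ∧ Epi p ∧ HasProjectiveDimensionLT ((Rep.resFunctor.{u} π).obj P) 2 := by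
    refine ⟨Rep.free K Q M.V, Rep.freeLift K Q M id, Rep.free_projective.{u, u, u}, ?_, ?_⟩
    · rw [Rep.epi_iff_surjective]
      exact fun x => ⟨Finsupp.single x (MonoidAlgebra.single 1 1), by simp⟩
    · obtain ⟨_, hw'⟩ := exists_shortExact_centralSubOne_freeRepMap (K := K) hπ hz hz' hker M.V
      have : Projective ((𝟭 _).obj (Rep.free K G M.V)) := Rep.free_projective.{u, u, u}
      exact hw'.hasProjectiveDimensionLT_X₃ 1 inferInstance inferInstance
  by_contra hG
  refine not_nontrivial_iff_subsingleton.2 ?_ h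
  exact subsingleton_ext_of_subsingleton_ext_succ (Rep.resFunctor.{u} (k := K) π)
    (centralSubOne K hz) (centralSubOne_app_res π hz map_z) exists_projective_cover hw i _
    (not_nontrivial_iff_subsingleton.1 hG)

theorem of_ker_eq_closure {σ : Type*} {z : σ → Subgroup.center G}
    (hz : LinearIndependent ℤ fun j => Additive.ofMul (z j)) {s : Finset σ} (hs : s.Nonempty)
    {i : ℕ} (h : RegularExtNontrivial K Q i) {π : G →* Q} (hπ : Function.Surjective π)
    (hker : π.ker = (Subgroup.closure (z '' s)).map (Subgroup.center G).subtype) :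
    RegularExtNontrivial K G (i + s.card) := by
  induction hs using Finset.Nonempty.cons_induction generalizing Q i with
  | singleton j =>
    refine h.of_ker_eq_zpowers hπ (z j).2 (fun finite => ?_) ?_
    · obtain ⟨k, hk, hzk⟩ := isOfFinOrder_iff_zpow_eq_one.1 finite
      refine hk (eq_zero_of_zpow_mem_closure hz (Finset.notMem_empty j) ?_)
      exact (Subtype.ext hzk : z j ^ k = 1) ▸ one_mem _
    · rw [hker, Finset.coe_singleton, Set.image_singleton, ← Subgroup.zpowers_eq_closure,
        MonoidHom.map_zpowers, Subgroup.subtype_apply]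
  | cons j s hj _ ih =>
    let N := (Subgroup.closure (z '' s)).map (Subgroup.center G).subtype
    have : N.Normal := normal_of_le_center (Subgroup.map_subtype_le _)
    have ker_eq : π.ker = N ⊔ Subgroup.zpowers (z j : G) := by
      rw [hker, Finset.coe_cons, Set.image_insert_eq, Set.insert_eq, Subgroup.closure_union,
        ← Subgroup.zpowers_eq_closure, Subgroup.map_sup, sup_comm, MonoidHom.map_zpowers,
        Subgroup.subtype_apply]
    have N_le_ker : N ≤ π.ker := ker_eq ▸ le_sup_left
    have h' : RegularExtNontrivial K (G ⧸ N) (i + 1) := by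
      refine h.of_ker_eq_zpowers (QuotientGroup.lift_surjective_of_surjective N π hπ N_le_ker)
        (map_mem_center (QuotientGroup.mk'_surjective N) (z j).2) (fun finite => ?_) ?_
      · obtain ⟨k, hk, hzk⟩ := isOfFinOrder_iff_zpow_eq_one.1 finite
        obtain ⟨y, hy, hyk⟩ := (QuotientGroup.eq_one_iff (z j ^ k : G)).1 hzk
        obtain rfl : y = z j ^ k := Subtype.ext hyk
        exact hk (eq_zero_of_zpow_mem_closure hz hj hy)
      · rw [QuotientGroup.ker_lift, ker_eq, Subgroup.map_sup, QuotientGroup.map_mk'_self,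
          bot_sup_eq, MonoidHom.map_zpowers]
    rw [Finset.card_cons, add_comm s.card, ← add_assoc]
    exact ih h' (QuotientGroup.mk'_surjective N) (QuotientGroup.ker_mk' N)

theorem of_quotient_center {σ : Type*} [Fintype σ] [Nonempty σ]
    (b : Module.Basis σ ℤ (Additive (Subgroup.center G))) {i : ℕ}
    (h : RegularExtNontrivial K (G ⧸ Subgroup.center G) i) :
    RegularExtNontrivial K G (i + Fintype.card σ) := by
  have closure_eq_top : Subgroup.closure (Set.range fun j => (b j).toMul) = ⊤ := by
    apply Subgroup.toAddSubgroup.injective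
    rw [Subgroup.toAddSubgroup_closure]
    exact (Submodule.span_int_eq_addSubgroupClosure _).symm.trans
      (congrArg Submodule.toAddSubgroup b.span_eq)
  refine h.of_ker_eq_closure (z := fun j => (b j).toMul) b.linearIndependent Finset.univ_nonempty
    (QuotientGroup.mk'_surjective (Subgroup.center G)) ?_
  rw [QuotientGroup.ker_mk', Finset.coe_univ, Set.image_univ, closure_eq_top,
    ← MonoidHom.range_eq_map, Subgroup.range_subtype]

end RegularExtNontrivial

end RegularExt

section LinearAlgebra

open Module

variable {ι K V : Type*} [Field K] [IsAlgClosed K] [AddCommGroup V] [Module K V]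
  [FiniteDimensional K V]

theorem exists_common_eigenvector {y : ι → End K V} (hy : ∀ i j, Commute (y i) (y j))
    {E : Submodule K V} (hE : E ≠ ⊥) (hyE : ∀ i, ∀ v ∈ E, y i v ∈ E) :
    ∃ v ∈ E, v ≠ 0 ∧ ∀ i, ∃ c : K, y i v = c • v := by
  induction E using WellFoundedLT.induction with
  | ind E ih =>
    by_cases hscalar : ∀ i, ∃ c : K, ∀ v ∈ E, y i v = c • v
    · obtain ⟨v, hv, hv0⟩ := E.ne_bot_iff.1 hE
      exact ⟨v, hv, hv0, fun i => (hscalar i).imp fun c hc => hc v hv⟩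
    push Not at hscalar
    obtain ⟨i, hi⟩ := hscalar
    have : Nontrivial E := Submodule.nontrivial_iff_ne_bot.2 hE
    obtain ⟨c, hc⟩ := End.exists_eigenvalue ((y i).restrict (hyE i))
    obtain ⟨w, hw⟩ := hc.exists_hasEigenvector
    have hwc : y i w = c • (w : V) := congrArg Subtype.val hw.apply_eq_smul
    obtain ⟨u, hu, huc⟩ := hi c
    have hlt : E ⊓ (y i).eigenspace c < E :=
      inf_lt_left.2 fun hle => huc (End.mem_eigenspace_iff.1 (hle hu))
    have hne : E ⊓ (y i).eigenspace c ≠ ⊥ := (Submodule.ne_bot_iff _).2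
      ⟨w, ⟨w.2, End.mem_eigenspace_iff.2 hwc⟩, fun h => hw.2 (Subtype.ext h)⟩
    obtain ⟨v, hv, hv'⟩ := ih _ hlt hne fun j v hv =>
      ⟨hyE j v hv.1, End.mapsTo_genEigenspace_of_comm (hy i j) c 1 hv.2⟩
    exact ⟨v, hv.1, hv'⟩

theorem isNilpotent_sub_one_of_forall_hasEigenvalue {f : End K V}
    (hf : ∀ c, f.HasEigenvalue c → c = 1) : IsNilpotent (f - 1) := by
  have htop : f.maxGenEigenspace 1 = ⊤ := by
    rw [← f.iSup_maxGenEigenspace_eq_top]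
    refine le_antisymm (le_iSup f.maxGenEigenspace 1) (iSup_le fun c => ?_)
    by_cases hc : f.HasEigenvalue c
    · rw [hf c hc]
    · have hbot : f.maxGenEigenspace c = ⊥ :=
        not_not.1 fun h => hc (End.HasUnifEigenvalue.lt zero_lt_one h)
      exact hbot ▸ bot_le
  refine ⟨finrank K V, LinearMap.ext fun v => ?_⟩
  have hv : v ∈ f.maxGenEigenspace 1 := htop ▸ Submodule.mem_top
  rw [End.maxGenEigenspace_eq_genEigenspace_finrank, End.mem_genEigenspace_nat] at hv
  simpa using hv

end LinearAlgebra

section SteinbergSystem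

open Module Function

/-- Elements `x i j` of a monoid which satisfy the Steinberg commutator relations; they need not
come in families indexed by a ring. The convention `x i i = 1` avoids carrying proofs of `i ≠ j`. -/
structure IsSteinbergSystem {ι M : Type*} [Monoid M] (x : ι → ι → M) : Prop where
  self (i : ι) : x i i = 1
  commute {i j p q : ι} (hjp : j ≠ p) (hiq : i ≠ q) : Commute (x i j) (x p q)
  comm_mul {i j l : ι} (hij : i ≠ j) (hjl : j ≠ l) (hil : i ≠ l) :
    x i j * x j l = x i l * x j l * x i j

namespace IsSteinbergSystem

section Monoid

variable {ι κ M N : Type*} [Monoid M] [Monoid N] {x : ι → ι → M}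

theorem comp (hx : IsSteinbergSystem x) {e : κ → ι} (he : Injective e) :
    IsSteinbergSystem fun i j => x (e i) (e j) where
  self i := hx.self (e i)
  commute hjp hiq := hx.commute (he.ne hjp) (he.ne hiq)
  comm_mul hij hjl hil := hx.comm_mul (he.ne hij) (he.ne hjl) (he.ne hil)

theorem map (hx : IsSteinbergSystem x) (f : M →* N) : IsSteinbergSystem fun i j => f (x i j) where
  self i := by rw [hx.self, map_one]
  commute hjp hiq := (hx.commute hjp hiq).map f
  comm_mul hij hjl hil := by simp only [← map_mul, hx.comm_mul hij hjl hil]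

theorem commute_row (hx : IsSteinbergSystem x) (a i j : ι) : Commute (x a i) (x a j) := by
  rcases eq_or_ne i a with rfl | hi
  · rw [hx.self]
    exact Commute.one_left _
  rcases eq_or_ne j a with rfl | hj
  · rw [hx.self]
    exact Commute.one_right _
  · exact hx.commute hi hj.symm

theorem row_mul (hx : IsSteinbergSystem x) {a i j : ι} (hi : i ≠ a) (hj : j ≠ a) (hij : i ≠ j) :
    x a i * x i j = x i j * (x a j * x a i) := by
  rw [hx.comm_mul hi.symm hij hj.symm, (hx.commute hij.symm hj.symm).eq, mul_assoc]

end Monoid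

variable {ι R V : Type*} [Ring R] [AddCommGroup V] [Module R V] {x : ι → ι → End R V}

theorem restrict (hx : IsSteinbergSystem x) {W : Submodule R V}
    (hW : ∀ i j, ∀ v ∈ W, x i j v ∈ W) :
    IsSteinbergSystem fun i j => (x i j).restrict (hW i j) where
  self i := LinearMap.ext fun v => Subtype.ext (LinearMap.congr_fun (hx.self i) v)
  commute hjp hiq :=
    LinearMap.ext fun v => Subtype.ext (LinearMap.congr_fun (hx.commute hjp hiq).eq v)
  comm_mul hij hjl hil :=
    LinearMap.ext fun v => Subtype.ext (LinearMap.congr_fun (hx.comm_mul hij hjl hil) v)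

theorem mapQ (hx : IsSteinbergSystem x) {W : Submodule R V} (hW : ∀ i j, ∀ v ∈ W, x i j v ∈ W) :
    IsSteinbergSystem fun i j => W.mapQ W (x i j) (hW i j) where
  self i := W.linearMap_qext (LinearMap.ext fun v =>
    congrArg W.mkQ (LinearMap.congr_fun (hx.self i) v))
  commute hjp hiq := W.linearMap_qext (LinearMap.ext fun v =>
    congrArg W.mkQ (LinearMap.congr_fun (hx.commute hjp hiq).eq v))
  comm_mul hij hjl hil := W.linearMap_qext (LinearMap.ext fun v =>
    congrArg W.mkQ (LinearMap.congr_fun (hx.comm_mul hij hjl hil) v))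

end IsSteinbergSystem

end SteinbergSystem

section RowWeights

open Module Function

variable {ι : Type*}

theorem exists_ne_and_ne_of_three_le_card [Fintype ι] (hι : 3 ≤ Fintype.card ι) (i j : ι) :
    ∃ l, l ≠ i ∧ l ≠ j := by
  classical
  obtain ⟨l, -, hl⟩ := Finset.exists_mem_notMem_of_card_lt_card
    (s := {i, j}) (t := Finset.univ) (Finset.card_le_two.trans_lt hι)
  exact ⟨l, by simpa using hl⟩

section Moves

variable {R : Type*} [MonoidWithZero R] [IsLeftCancelMulZero R] [Fintype ι] [DecidableEq ι]
  {X : Set (ι → R)} {a b : ι} {χ : ι → R}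

theorem exists_apply_ne_of_update_mul_mem (hι : 3 ≤ Fintype.card ι) (hne : ∀ χ ∈ X, ∀ i, χ i ≠ 0)
    (hmove : ∀ χ ∈ X, ∀ i j, i ≠ a → j ≠ a → i ≠ j → update χ i (χ i * χ j) ∈ X)
    (hχ : χ ∈ X) (hba : b ≠ a) (hχb : χ b ≠ 1) : ∃ ψ ∈ X, ψ b ≠ χ b := by
  obtain ⟨d, hda, hdb⟩ := exists_ne_and_ne_of_three_le_card hι a b
  obtain ⟨φ, hφ, hφb, hφd⟩ : ∃ φ ∈ X, φ b = χ b ∧ φ d ≠ 1 := by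
    by_cases hχd : χ d = 1
    · refine ⟨_, hmove χ hχ d b hda hba hdb, update_of_ne hdb.symm _ _, ?_⟩
      rwa [update_self, hχd, one_mul]
    · exact ⟨χ, hχ, rfl, hχd⟩
  refine ⟨_, hmove φ hφ b d hba hda hdb.symm, ?_⟩
  rw [update_self, ← hφb]
  exact (mul_eq_left₀ (hne φ hφ b)).not.2 hφd

/-- The functions are `χ`, its images under the moves `χ i ↦ χ i * χ b`, and one function which
differs from all of these at `b`. -/
theorem exists_injective_of_update_mul_mem (hι : 3 ≤ Fintype.card ι) (hne : ∀ χ ∈ X, ∀ i, χ i ≠ 0)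
    (hmove : ∀ χ ∈ X, ∀ i j, i ≠ a → j ≠ a → i ≠ j → update χ i (χ i * χ j) ∈ X)
    (hχ : χ ∈ X) (hba : b ≠ a) (hχb : χ b ≠ 1) :
    ∃ w : ι → ι → R, Injective w ∧ ∀ i, w i ∈ X := by
  obtain ⟨ψ, hψ, hψb⟩ := exists_apply_ne_of_update_mul_mem hι hne hmove hχ hba hχb
  let w (i : ι) : ι → R := if i = a then ψ else if i = b then χ else update χ i (χ i * χ b)
  have hw_a : w a = ψ := if_pos rfl
  have hw_b : w b = χ := by simp [w, hba]
  have hw {i : ι} (hi : i ≠ a) (hib : i ≠ b) : w i = update χ i (χ i * χ b) := by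
    simp [w, hi, hib]
  have hw_self {i : ι} (hi : i ≠ a) (hib : i ≠ b) : w i i ≠ χ i := by
    rw [hw hi hib, update_self]
    exact (mul_eq_left₀ (hne χ hχ i)).not.2 hχb
  have hw_of_ne {i j : ι} (hi : i ≠ a) (hij : i ≠ j) : w i j = χ j := by
    rcases eq_or_ne i b with rfl | hib
    · rw [hw_b]
    · rw [hw hi hib, update_of_ne hij.symm]
  have hw_apply_b {i : ι} (hi : i ≠ a) : w i b = χ b := by
    rcases eq_or_ne i b with rfl | hib
    · rw [hw_b]
    · exact hw_of_ne hi hib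
  have hw_ne {i j : ι} (hi : i ≠ a) (hij : i ≠ j) : w i ≠ w j := by
    intro h
    rcases eq_or_ne j a with rfl | hj
    · exact hψb (by rw [← hw_a, ← h, hw_apply_b hi])
    rcases eq_or_ne i b with rfl | hib
    · exact hw_self hj hij.symm (by rw [← h, hw_of_ne hi hij])
    · exact hw_self hi hib (by rw [h, hw_of_ne hj hij.symm])
  refine ⟨w, fun i j hij => by_contra fun h => ?_, fun i => ?_⟩
  · rcases eq_or_ne i a with rfl | hi
    · exact hw_ne (Ne.symm h) (Ne.symm h) hij.symm
    · exact hw_ne hi h hij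
  · rcases eq_or_ne i a with rfl | hi
    · rwa [hw_a]
    rcases eq_or_ne i b with rfl | hib
    · rwa [hw_b]
    · exact hw hi hib ▸ hmove χ hχ i b hi hba hib

end Moves

section IsRowWeight

variable {R V : Type*} [CommRing R] [AddCommGroup V] [Module R V] {x : ι → ι → End R V} {a : ι}
  {χ : ι → R}

/-- The function `χ` lists the eigenvalues of `x a j`, for varying `j`, on a common eigenvector. -/
def IsRowWeight (x : ι → ι → End R V) (a : ι) (χ : ι → R) : Prop :=
  ∃ v : V, v ≠ 0 ∧ ∀ j, x a j v = χ j • v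

theorem IsRowWeight.apply_ne_zero (hχ : IsRowWeight x a χ) {j : ι}
    (hinj : Injective (x a j)) : χ j ≠ 0 := by
  obtain ⟨v, hv, hvχ⟩ := hχ
  intro h
  refine hv (hinj ?_)
  rw [hvχ, h, zero_smul, map_zero]

theorem IsSteinbergSystem.isRowWeight_update [DecidableEq ι] (hx : IsSteinbergSystem x)
    (hχ : IsRowWeight x a χ) {i j : ι} (hi : i ≠ a) (hj : j ≠ a) (hij : i ≠ j)
    (hinj : Injective (x i j)) : IsRowWeight x a (update χ i (χ i * χ j)) := by
  obtain ⟨v, hv, hvχ⟩ := hχ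
  refine ⟨x i j v, fun h => hv (hinj (h.trans (map_zero _).symm)), fun l => ?_⟩
  rcases eq_or_ne l i with rfl | hli
  · rw [update_self, ← End.mul_apply, hx.row_mul hi hj hij, End.mul_apply, End.mul_apply, hvχ,
      map_smul, hvχ, map_smul, map_smul, smul_smul]
  · rw [update_of_ne hli, ← End.mul_apply, (hx.commute hli hj.symm).eq, End.mul_apply, hvχ,
      map_smul]

end IsRowWeight

variable {K V : Type*} [Field K] [AddCommGroup V] [Module K V] {x : ι → ι → End K V}

theorem card_le_finrank_of_isRowWeight [FiniteDimensional K V] {σ : Type*} [Fintype σ]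
    (hx : IsSteinbergSystem x) (a : ι) {w : σ → ι → K} (hw : Injective w)
    (hwx : ∀ s, IsRowWeight x a (w s)) : Fintype.card σ ≤ finrank K V := by
  choose v hv0 hv using hwx
  have hindep : iSupIndep fun χ : ι → K => ⨅ j, (x a j).maxGenEigenspace (χ j) :=
    End.independent_iInf_maxGenEigenspace_of_forall_mapsTo (x a) fun i j c =>
      End.mapsTo_maxGenEigenspace_of_comm (hx.commute_row a j i) c
  refine ((hindep.comp hw).linearIndependent _ (fun s => ?_) hv0).fintype_card_le_finrank
  refine (Submodule.mem_iInf _).2 fun j => ?_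
  exact (x a j).genEigenspace_le_maximal (w s j) 1 (End.mem_eigenspace_iff.2 (hv s j))

namespace IsSteinbergSystem

theorem exists_isRowWeight [IsAlgClosed K] [FiniteDimensional K V] (hx : IsSteinbergSystem x)
    {a b : ι} {c : K} (hc : (x a b).HasEigenvalue c) : ∃ χ, IsRowWeight x a χ ∧ χ b = c := by
  obtain ⟨v, hv, hv0, h⟩ := exists_common_eigenvector (hx.commute_row a) hc fun i v hv =>
    End.mapsTo_genEigenspace_of_comm (hx.commute_row a b i) c 1 hv
  choose χ hχ using h
  refine ⟨χ, ⟨v, hv0, hχ⟩, smul_left_injective K hv0 ?_⟩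
  exact (hχ b).symm.trans (End.mem_eigenspace_iff.1 hv)

theorem isNilpotent_sub_one [IsAlgClosed K] [FiniteDimensional K V] [Fintype ι]
    (hx : IsSteinbergSystem x) (hinj : ∀ i j, Injective (x i j)) (hι : 3 ≤ Fintype.card ι)
    (hV : finrank K V < Fintype.card ι) (a b : ι) : IsNilpotent (x a b - 1) := by
  classical
  rcases eq_or_ne b a with rfl | hba
  · rw [hx.self, sub_self]
    exact IsNilpotent.zero
  refine isNilpotent_sub_one_of_forall_hasEigenvalue fun c hc => ?_
  by_contra hc1
  obtain ⟨χ, hχ, rfl⟩ := hx.exists_isRowWeight hc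
  obtain ⟨w, hw, hwx⟩ := exists_injective_of_update_mul_mem (X := {φ | IsRowWeight x a φ}) hι
    (fun φ hφ j => hφ.apply_ne_zero (hinj a j))
    (fun φ hφ i j hi hj hij => hx.isRowWeight_update hφ hi hj hij (hinj i j)) hχ hba hc1
  exact hV.not_ge (card_le_finrank_of_isRowWeight hx a hw hwx)

end IsSteinbergSystem

end RowWeights

section Unipotent

open Module

variable {R M : Type*} [Ring R] [AddCommGroup M] [Module R M] {f : End R M} {W : Submodule R M}

theorem isNilpotent_restrict_sub_one (hf : IsNilpotent (f - 1)) (hW : ∀ v ∈ W, f v ∈ W) :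
    IsNilpotent (f.restrict hW - 1) := by
  have hW' : ∀ v ∈ W, (f - 1) v ∈ W := fun v hv => sub_mem (hW v hv) hv
  exact (End.isNilpotent.restrict hW' hf : IsNilpotent ((f - 1).restrict hW'))

theorem isNilpotent_mapQ_sub_one (hf : IsNilpotent (f - 1)) (hW : ∀ v ∈ W, f v ∈ W) :
    IsNilpotent (W.mapQ W f hW - 1) := by
  have hW' : ∀ v ∈ W, (f - 1) v ∈ W := fun v hv => sub_mem (hW v hv) hv
  have hmapQ : W.mapQ W f hW - 1 = W.mapQ W (f - 1) hW' := W.linearMap_qext rfl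
  exact hmapQ ▸ End.IsNilpotent.mapQ hW' hf

end Unipotent

section UnipotentSteinbergSystem

open Module Function

variable {ι : Type*}

section RowFixed

variable {R V : Type*} [Ring R] [AddCommGroup V] [Module R V] {x : ι → ι → End R V}

/-- The vectors fixed by all the `x a j`. In a Steinberg system they are stable under the `x i j`
with `i, j ≠ a`, which is a system with one index fewer acting on this submodule and its
quotient. -/
def rowFixed (x : ι → ι → End R V) (a : ι) : Submodule R V :=
  ⨅ j, LinearMap.eqLocus (x a j) 1

theorem mem_rowFixed {a : ι} {v : V} : v ∈ rowFixed x a ↔ ∀ j, x a j v = v := by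
  simp [rowFixed, Submodule.mem_iInf]

namespace IsSteinbergSystem

theorem apply_mem_rowFixed (hx : IsSteinbergSystem x) {a i j : ι} (hi : i ≠ a) (hj : j ≠ a)
    {v : V} (hv : v ∈ rowFixed x a) : x i j v ∈ rowFixed x a := by
  rcases eq_or_ne i j with rfl | hij
  · rwa [hx.self]
  rw [mem_rowFixed] at hv ⊢
  intro l
  rcases eq_or_ne l i with rfl | hli
  · rw [← End.mul_apply, hx.row_mul hi hj hij, End.mul_apply, End.mul_apply, hv, hv]
  · rw [← End.mul_apply, (hx.commute hli hj.symm).eq, End.mul_apply, hv]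

/-- If the `x i j` with `i, j ≠ a` act trivially modulo the vectors fixed by row `a`, then the
commutator relation expresses `x a j - 1` through `x i j - 1`. -/
theorem row_apply_sub (hx : IsSteinbergSystem x) {a i j : ι} (hi : i ≠ a) (hj : j ≠ a)
    (hij : i ≠ j) (hquot : ∀ v, x i j v - v ∈ rowFixed x a) (v : V) :
    x a j (x a i v) - x a i v = (x i j v - v) - (x i j (x a i v) - x a i v) := by
  have hcomm := LinearMap.congr_fun (hx.comm_mul hi.symm hij hj.symm) v
  have hfix_i := mem_rowFixed.1 (hquot v) i
  have hfix_j := mem_rowFixed.1 (hquot (x a i v)) j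
  simp only [End.mul_apply] at hcomm
  rw [map_sub, hcomm] at hfix_i
  rw [map_sub, sub_eq_iff_eq_add] at hfix_j
  rw [hfix_j] at hfix_i
  rw [← hfix_i]
  abel

theorem rowFixed_eq_top (hx : IsSteinbergSystem x) {a : ι} (hι : ∀ j, ∃ i, i ≠ a ∧ i ≠ j)
    (hsurj : ∀ i, Surjective (x a i))
    (hsub : ∀ i j, i ≠ a → j ≠ a → ∀ v ∈ rowFixed x a, x i j v = v)
    (hquot : ∀ i j, i ≠ a → j ≠ a → ∀ v, x i j v - v ∈ rowFixed x a) : rowFixed x a = ⊤ := by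
  have hmem (j : ι) (v : V) : x a j v - v ∈ rowFixed x a := by
    rcases eq_or_ne j a with rfl | hj
    · simp [hx.self]
    obtain ⟨i, hi, hij⟩ := hι j
    obtain ⟨v, rfl⟩ := hsurj i v
    rw [hx.row_apply_sub hi hj hij (hquot i j hi hj)]
    exact sub_mem (hquot i j hi hj _) (hquot i j hi hj _)
  refine eq_top_iff.2 fun v _ => mem_rowFixed.2 fun j => ?_
  rcases eq_or_ne j a with rfl | hj
  · simp [hx.self]
  obtain ⟨i, hi, hij⟩ := hι j
  obtain ⟨v, rfl⟩ := hsurj i v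
  have hfix := hsub i j hi hj _ (hmem i v)
  rw [map_sub] at hfix
  rw [← sub_eq_zero, hx.row_apply_sub hi hj hij (hquot i j hi hj), sub_sub_sub_comm,
    ← neg_sub (x i j (x a i v)), hfix, neg_sub, sub_self]

end IsSteinbergSystem

end RowFixed

variable {K V : Type*} [Field K] [IsAlgClosed K] [AddCommGroup V] [Module K V]
  [FiniteDimensional K V] {x : ι → ι → End K V}

namespace IsSteinbergSystem

theorem rowFixed_ne_bot [Nontrivial V] (hx : IsSteinbergSystem x) {a : ι}
    (hnil : ∀ j, IsNilpotent (x a j - 1)) : rowFixed x a ≠ ⊥ := by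
  obtain ⟨v, -, hv0, hv⟩ :=
    exists_common_eigenvector (hx.commute_row a) (E := ⊤) top_ne_bot (by simp)
  refine (Submodule.ne_bot_iff _).2 ⟨v, mem_rowFixed.2 fun j => ?_, hv0⟩
  obtain ⟨c, hc⟩ := hv j
  have heig : (x a j - 1).HasEigenvector (c - 1) v :=
    ⟨End.mem_eigenspace_iff.2 (by simp [hc, sub_smul]), hv0⟩
  have hc1 := (End.HasUnifEigenvalue.isNilpotent_of_isNilpotent (hnil j)
    (End.hasEigenvalue_of_hasEigenvector heig)).eq_zero
  rw [hc, sub_eq_zero.1 hc1, one_smul]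

theorem eq_one_of_isNilpotent [Fintype ι] (hx : IsSteinbergSystem x)
    (hnil : ∀ i j, IsNilpotent (x i j - 1))
    (hV : finrank K V < Fintype.card ι) (a b : ι) : x a b = 1 := by
  classical
  induction hn : Fintype.card ι generalizing ι V with
  | zero => omega
  | succ n ih =>
    let W := rowFixed x a
    suffices hWtop : W = ⊤ from
      LinearMap.ext fun v => mem_rowFixed.1 (hWtop ▸ Submodule.mem_top : v ∈ W) b
    by_contra hWtop
    have : Nontrivial V := by
      by_contra h
      have := not_nontrivial_iff_subsingleton.1 h
      exact hWtop (Subsingleton.elim _ _)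
    have hWpos : 0 < finrank K W :=
      Submodule.one_le_finrank_iff.2 (hx.rowFixed_ne_bot (hnil a))
    have hWlt : finrank K W < finrank K V := Submodule.finrank_lt hWtop
    have hWquot := W.finrank_quotient_add_finrank
    have hcard : Fintype.card {i // i ≠ a} = n := by
      rw [Fintype.card_subtype_compl, Fintype.card_subtype_eq, hn, Nat.add_sub_cancel]
    have hx' : IsSteinbergSystem fun i j : {i // i ≠ a} => x i j :=
      hx.comp Subtype.val_injective
    have hW (i j : {i // i ≠ a}) (v : V) (hv : v ∈ W) : x i j v ∈ W :=
      hx.apply_mem_rowFixed i.2 j.2 hv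
    refine hWtop (hx.rowFixed_eq_top (exists_ne_and_ne_of_three_le_card (by omega) a)
      (fun i => ?_) (fun i j hi hj v hv => ?_) fun i j hi hj v => ?_)
    · have hunit := (hnil a i).isUnit_one_add
      rw [add_sub_cancel] at hunit
      exact ((End.isUnit_iff _).1 hunit).2
    · have h := ih (hx'.restrict hW) (fun i j => ?_) (by omega) ⟨i, hi⟩ ⟨j, hj⟩ hcard
      · exact congrArg Subtype.val (LinearMap.congr_fun h ⟨v, hv⟩)
      · exact isNilpotent_restrict_sub_one (hnil i j) (hW i j)
    · have h := ih (hx'.mapQ hW) (fun i j => ?_) (by omega) ⟨i, hi⟩ ⟨j, hj⟩ hcard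
      · exact (Submodule.Quotient.eq W).1 (LinearMap.congr_fun h (W.mkQ v))
      · exact isNilpotent_mapQ_sub_one (hnil i j) (hW i j)

end IsSteinbergSystem

end UnipotentSteinbergSystem

section SteinbergGroup

open Module

/-- The generator `x_{ij}(r)` of the Steinberg group, extended to all pairs of indices by
`x_{ii}(r) = 1` to match `IsSteinbergSystem`. -/
def SteinbergGroup.x {n : ℕ} {R : Type v} [Ring R] (i j : Fin n) (r : R) : SteinbergGroup n R :=
  if hij : i ≠ j then PresentedGroup.of (⟨(i, j), hij⟩, r) else 1

namespace SteinbergGroup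

variable {n : ℕ} {R : Type v} [Ring R]

theorem x_of_ne {i j : Fin n} (hij : i ≠ j) (r : R) :
    x i j r = PresentedGroup.of (⟨(i, j), hij⟩, r) :=
  dif_pos hij

theorem x_self (i : Fin n) (r : R) : x i i r = 1 :=
  dif_neg (not_not.2 rfl)

theorem commute_x {i j p q : Fin n} (hjp : j ≠ p) (hiq : i ≠ q) (r s : R) :
    Commute (x i j r) (x p q s) := by
  rcases eq_or_ne i j with rfl | hij
  · rw [x_self]
    exact Commute.one_left _
  rcases eq_or_ne p q with rfl | hpq
  · rw [x_self]
    exact Commute.one_right _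
  have hrel : PresentedGroup.mk {w | SteinbergRel n R w} _ = 1 :=
    PresentedGroup.one_of_mem (SteinbergRel.comm_one i j p q hij hpq hjp hiq r s)
  simp only [map_mul, map_inv] at hrel
  rw [x_of_ne hij, x_of_ne hpq]
  exact mul_inv_eq_iff_eq_mul.1 (mul_inv_eq_one.1 hrel)

theorem x_mul_x {i j l : Fin n} (hij : i ≠ j) (hjl : j ≠ l) (hil : i ≠ l) (r s : R) :
    x i j r * x j l s = x i l (r * s) * x j l s * x i j r := by
  have hrel : PresentedGroup.mk {w | SteinbergRel n R w} _ = 1 :=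
    PresentedGroup.one_of_mem (SteinbergRel.comm_mul i j l hij hjl hil r s)
  simp only [map_mul, map_inv] at hrel
  rw [x_of_ne hij, x_of_ne hjl, x_of_ne hil]
  exact mul_inv_eq_iff_eq_mul.1 (mul_inv_eq_iff_eq_mul.1 (mul_inv_eq_one.1 hrel))

theorem isSteinbergSystem_x_one : IsSteinbergSystem fun i j : Fin n => x i j (1 : R) where
  self i := x_self i 1
  commute hjp hiq := commute_x hjp hiq 1 1
  comm_mul hij hjl hil := by simpa only [mul_one] using x_mul_x hij hjl hil (1 : R) 1

theorem hom_eq_one_of_x_one {M : Type*} [Monoid M] (hn : 3 ≤ n) {f : SteinbergGroup n R →* M}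
    (hf : ∀ i j, f (x i j 1) = 1) : f = 1 := by
  refine MonoidHom.eq_of_eqOn_dense (PresentedGroup.closure_range_of _) ?_
  rintro _ ⟨⟨⟨⟨i, j⟩, hij⟩, r⟩, rfl⟩
  obtain ⟨l, hli, hlj⟩ := exists_ne_and_ne_of_three_le_card (by simpa using hn) i j
  have h := congrArg f (x_mul_x hli.symm hlj hij r 1)
  simp only [map_mul, hf, mul_one] at h
  rw [← x_of_ne hij, MonoidHom.one_apply]
  exact ((Group.isUnit _).map f).mul_eq_right.1 h.symm

/-- The generators are commutators. -/
theorem hom_eq_one_of_commute {H : Type*} [Group H] (hn : 3 ≤ n) {f : SteinbergGroup n R →* H}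
    (hf : ∀ a b, Commute (f a) (f b)) : f = 1 := by
  refine PresentedGroup.ext fun ⟨⟨⟨i, j⟩, hij⟩, r⟩ => ?_
  obtain ⟨l, hli, hlj⟩ := exists_ne_and_ne_of_three_le_card (by simpa using hn) i j
  have h := congrArg f (x_mul_x hli.symm hlj hij r 1)
  simp only [map_mul, mul_one, mul_assoc] at h
  rw [(hf (x i l r) _).eq, x_of_ne hij] at h
  exact right_eq_mul.1 h

theorem hom_moduleEnd_eq_one_of_isAlgClosed (hn : 3 ≤ n) {K V : Type*} [Field K] [IsAlgClosed K]
    [AddCommGroup V] [Module K V] [FiniteDimensional K V] (hV : finrank K V < n)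
    (f : SteinbergGroup n R →* End K V) : f = 1 := by
  have hsys := (isSteinbergSystem_x_one (n := n) (R := R)).map f
  have hinj (i j : Fin n) : Function.Injective (f (x i j 1)) :=
    ((End.isUnit_iff _).1 ((Group.isUnit _).map f)).1
  have hcard := Fintype.card_fin n
  exact hom_eq_one_of_x_one hn (hsys.eq_one_of_isNilpotent
    (hsys.isNilpotent_sub_one hinj (by omega) (by omega)) (by omega))

theorem hom_moduleEnd_eq_one (hn : 3 ≤ n) {A M : Type*} [CommRing A] [IsDomain A] [AddCommGroup M]
    [Module A M] [Module.Free A M] [Module.Finite A M] (hM : finrank A M < n)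
    (f : SteinbergGroup n R →* End A M) : f = 1 := by
  let K := AlgebraicClosure (FractionRing A)
  have : FaithfulSMul A K := FaithfulSMul.trans A (FractionRing A) K
  have hinj : Function.Injective (End.baseChangeHom A K M) :=
    LinearMap.baseChangeHom_injective A M K
  have hK := hom_moduleEnd_eq_one_of_isAlgClosed hn (by rwa [finrank_baseChange])
    ((End.baseChangeHom A K M : End A M →* End K (TensorProduct A K M)).comp f)
  refine MonoidHom.ext fun g => hinj ?_
  exact (DFunLike.congr_fun hK g).trans (map_one _).symm

end SteinbergGroup

/-- Automorphisms of an abelian group, written multiplicatively, as `ℤ`-linear endomorphisms, so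
that results on linear representations apply to them. -/
def mulAutToIntEnd (A : Type*) [CommGroup A] : MulAut A →* End ℤ (Additive A) where
  toFun φ := (MonoidHom.toAdditive φ.toMonoidHom).toIntLinearMap
  map_one' := rfl
  map_mul' _ _ := rfl

theorem mulAutToIntEnd_injective (A : Type*) [CommGroup A] :
    Function.Injective (mulAutToIntEnd A) :=
  fun _ _ h => MulEquiv.ext fun a => LinearMap.congr_fun h (Additive.ofMul a)

theorem SteinbergGroup.hom_mulAut_eq_one {n : ℕ} {R : Type v} [Ring R] (hn : 3 ≤ n) {A : Type*}
    [CommGroup A] [Module.Free ℤ (Additive A)] [Module.Finite ℤ (Additive A)]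
    (hA : finrank ℤ (Additive A) < n) (f : SteinbergGroup n R →* MulAut A) : f = 1 :=
  MonoidHom.ext fun g => mulAutToIntEnd_injective A
    (DFunLike.congr_fun (hom_moduleEnd_eq_one hn hA ((mulAutToIntEnd A).comp f)) g)

end SteinbergGroup

section NilpotentGroup

open Subgroup
open scoped commutatorElement IsMulCommutative

variable {G : Type*} [Group G]

theorem commutatorElement_pow_left {x g : G} (h : ⁅x, g⁆ ∈ center G) (m : ℕ) :
    ⁅x ^ m, g⁆ = ⁅x, g⁆ ^ m := by
  induction m with
  | zero => simp only [pow_zero, commutatorElement_one_left]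
  | succ m ih =>
    rw [pow_succ', commutatorElement_mul_left_eq_conj_mul, ih, mem_center_iff.1 (pow_mem h m) x,
      mul_inv_cancel_right, pow_succ]

theorem mem_upperCentralSeries_of_pow_mem (hG : ∀ g : G, g ≠ 1 → ¬ IsOfFinOrder g) {m : ℕ}
    (hm : 0 < m) {i : ℕ} {x : G} (hx : x ∈ Subgroup.upperCentralSeries G (i + 1))
    (hxm : x ^ m ∈ Subgroup.upperCentralSeries G i) : x ∈ Subgroup.upperCentralSeries G i := by
  induction i generalizing x with
  | zero =>
    rw [Subgroup.upperCentralSeries_zero, mem_bot] at hxm ⊢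
    by_contra h
    exact hG x h (isOfFinOrder_iff_pow_eq_one.2 ⟨m, hm, hxm⟩)
  | succ i ih =>
    let π := QuotientGroup.mk' (Subgroup.upperCentralSeries G i)
    have hπ (y : G) : y ∈ Subgroup.upperCentralSeries G i ↔ π y = 1 :=
      (QuotientGroup.eq_one_iff y).symm
    rw [Subgroup.mem_upperCentralSeries_succ_iff] at hx hxm ⊢
    intro g
    refine ih (hx g) ((hπ _).2 ?_)
    have hcenter : ⁅π x, π g⁆ ∈ center _ := by
      refine mem_center_iff.2 ((QuotientGroup.mk'_surjective _).forall.2 fun y => ?_)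
      have h := (hπ _).1 (Subgroup.mem_upperCentralSeries_succ_iff.1 (hx g) y)
      rw [map_commutatorElement, commutatorElement_eq_one_iff_mul_comm] at h
      exact (map_commutatorElement π x g ▸ h).symm
    rw [map_pow, map_commutatorElement, ← commutatorElement_pow_left hcenter, ← map_pow,
      ← map_commutatorElement, (hπ _).1 (hxm g)]

theorem not_isOfFinOrder_quotient_center [Group.IsNilpotent G]
    (hG : ∀ g : G, g ≠ 1 → ¬ IsOfFinOrder g) (q : G ⧸ center G) (hq : q ≠ 1) :
    ¬ IsOfFinOrder q := by
  obtain ⟨x, rfl⟩ := QuotientGroup.mk_surjective q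
  intro h
  obtain ⟨m, hm, hxm⟩ := isOfFinOrder_iff_pow_eq_one.1 h
  rw [← QuotientGroup.mk_pow, QuotientGroup.eq_one_iff, ← Subgroup.upperCentralSeries_one] at hxm
  refine hq ((QuotientGroup.eq_one_iff x).2 ?_)
  have descend (i : ℕ) (hx : x ∈ Subgroup.upperCentralSeries G (i + 1)) : x ∈ center G := by
    induction i with
    | zero => rwa [zero_add, Subgroup.upperCentralSeries_one] at hx
    | succ i ih =>
      exact ih (mem_upperCentralSeries_of_pow_mem hG hm hx
        (Subgroup.upperCentralSeries_mono G (Nat.le_add_left 1 i) hxm))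
  obtain ⟨n, hn⟩ := Group.IsNilpotent.nilpotent G
  exact descend n (Subgroup.upperCentralSeries_mono G n.le_succ (hn ▸ mem_top x))

theorem exists_finite_closure_sup_inf_ker_eq {H : Type*} [Group H] (π : G →* H) {K : Subgroup G}
    (hK : (K.map π).FG) : ∃ S : Set G, S.Finite ∧ closure S ⊔ K ⊓ π.ker = K := by
  obtain ⟨T, hT, hTfin⟩ := (fg_iff _).1 hK
  have hTsub : T ⊆ π '' K := fun t ht => hT.le (subset_closure ht)
  obtain ⟨S, hSK, hSfin, rfl⟩ := Set.exists_subset_image_finite_and.1 ⟨T, hTsub, hTfin, rfl⟩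
  have hSK : closure S ≤ K := (closure_le K).2 hSK
  refine ⟨S, hSfin, le_antisymm (sup_le hSK inf_le_left) fun x hx => ?_⟩
  obtain ⟨y, hy, hyx⟩ : π x ∈ (closure S).map π := by
    rw [MonoidHom.map_closure, hT]
    exact mem_map_of_mem π hx
  rw [← mul_inv_cancel_left y x]
  refine mul_mem_sup hy (mem_inf.2 ⟨mul_mem (inv_mem (hSK hy)) hx, ?_⟩)
  rw [MonoidHom.mem_ker, map_mul, map_inv, hyx, inv_mul_cancel]

theorem fg_of_fg_map_of_fg_inf_ker {H : Type*} [Group H] (π : G →* H) {K : Subgroup G}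
    (hmap : (K.map π).FG) (hker : (K ⊓ π.ker).FG) : K.FG := by
  obtain ⟨S, hSfin, hS⟩ := exists_finite_closure_sup_inf_ker_eq π hmap
  exact hS ▸ ((fg_iff _).2 ⟨S, rfl, hSfin⟩).sup hker

theorem subgroup_fg_of_commGroup {A : Type*} [CommGroup A] [Group.FG A] (H : Subgroup A) :
    H.FG := by
  have : Module.Finite ℤ (Additive A) := Module.Finite.iff_addGroup_fg.2 inferInstance
  have hfg : (AddSubgroup.toIntSubmodule (toAddSubgroup H)).FG := IsNoetherian.noetherian _
  rwa [Submodule.fg_iff_addSubgroup_fg, AddSubgroup.toIntSubmodule_toAddSubgroup,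
    ← fg_iff_add_fg] at hfg

theorem fg_of_le_of_le_center {N H : Subgroup G} (hfg : N.FG) (hH : H ≤ N) (hN : N ≤ center G) :
    H.FG := by
  have : IsMulCommutative N := ⟨⟨fun a b => Subtype.ext (mem_center_iff.1 (hN b.2) a)⟩⟩
  have : Group.FG N := (Group.fg_iff_subgroup_fg N).2 hfg
  obtain ⟨S, hS⟩ := subgroup_fg_of_commGroup (H.subgroupOf N)
  refine (fg_iff _).2 ⟨N.subtype '' S, ?_, S.finite_toSet.image _⟩
  rw [← MonoidHom.map_closure, hS, subgroupOf_map_subtype, inf_of_le_left hH]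

theorem commutator_closure_le {N : Subgroup G} [N.Normal] {S T : Set G}
    (h : ∀ a ∈ S, ∀ b ∈ T, ⁅a, b⁆ ∈ N) : ⁅closure S, closure T⁆ ≤ N := by
  rw [← QuotientGroup.ker_mk' N, ← Subgroup.map_eq_bot_iff, map_commutator, MonoidHom.map_closure,
    MonoidHom.map_closure, commutator_eq_bot_iff_le_centralizer, closure_le, centralizer_closure]
  rintro _ ⟨a, ha, rfl⟩
  refine mem_centralizer_iff.2 ?_
  rintro _ ⟨b, hb, rfl⟩
  refine (commutatorElement_eq_one_iff_mul_comm.1 ?_).symm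
  rw [← map_commutatorElement]
  exact (QuotientGroup.eq_one_iff _).2 (h a ha b hb)

/-- Central elements contribute nothing to commutators, so `⁅K, ⊤⁆` is generated by the commutators
of finitely many lifts of generators of `K.map π` with finitely many generators of `G`. -/
theorem fg_commutator_top_of_le_center [Group.FG G] {H : Type*} [Group H] {π : G →* H}
    (hπ : π.ker ≤ center G) {K : Subgroup G} (hK : (K.map π).FG)
    (hcenter : ⁅K, (⊤ : Subgroup G)⁆ ≤ center G) : ⁅K, (⊤ : Subgroup G)⁆.FG := by
  obtain ⟨S, hSfin, hS⟩ := exists_finite_closure_sup_inf_ker_eq π hK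
  obtain ⟨T, hT, hTfin⟩ := Group.fg_iff.1 ‹Group.FG G›
  let D : Subgroup G := closure (Set.image2 (⁅·, ·⁆) S T)
  have hSK : S ⊆ K := fun a ha => hS.le (mem_sup_left (subset_closure ha))
  have hD : D ≤ ⁅K, (⊤ : Subgroup G)⁆ := by
    rw [closure_le, Set.image2_subset_iff]
    exact fun a ha b _ => commutator_mem_commutator (hSK ha) (mem_top b)
  have : D.Normal := normal_of_le_center (hD.trans hcenter)
  suffices hle : ⁅K, (⊤ : Subgroup G)⁆ ≤ D from
    le_antisymm hle hD ▸ (fg_iff _).2 ⟨_, rfl, hSfin.image2 _ hTfin⟩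
  rw [← hS, ← hT, ← closure_eq (K ⊓ π.ker), ← Subgroup.closure_union]
  refine commutator_closure_le ?_
  rintro a (ha | ha) b hb
  · exact subset_closure (Set.mem_image2_of_mem ha hb)
  · rw [commutatorElement_eq_one_iff_mul_comm.2 (mem_center_iff.1 (hπ ha.2) b).symm]
    exact one_mem D

theorem fg_of_lowerCentralSeries_eq_bot (n : ℕ) {G : Type*} [Group G] [Group.FG G]
    (h : (⊤ : Subgroup G).lowerCentralSeries n = ⊥) (K : Subgroup G) : K.FG := by
  induction n generalizing G with
  | zero =>
    have hK : K = ⊥ := le_bot_iff.1 (le_top.trans h.le)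
    exact hK ▸ FG.bot
  | succ n ih =>
    set L := (⊤ : Subgroup G).lowerCentralSeries n with hL
    have hLcenter : L ≤ center G := commutator_top_right_eq_bot_iff_le_center.1 h
    have : L.Normal := normal_of_le_center hLcenter
    let π := QuotientGroup.mk' L
    have hker : π.ker = L := QuotientGroup.ker_mk' L
    have hmap (K : Subgroup G) : (K.map π).FG := by
      refine ih ?_ _
      rw [← map_top_of_surjective π (QuotientGroup.mk'_surjective L), ← map_lowerCentralSeries,
        ← hL, Subgroup.map_eq_bot_iff, hker]
    have hLfg : L.FG := by
      cases n with
      | zero => exact hL ▸ Group.fg_def.1 inferInstance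
      | succ n =>
        exact fg_commutator_top_of_le_center (hker.trans_le hLcenter) (hmap _) hLcenter
    exact fg_of_fg_map_of_fg_inf_ker π (hmap K)
      (fg_of_le_of_le_center hLfg (inf_le_right.trans hker.le) hLcenter)

theorem fg_of_isNilpotent [Group.FG G] [Group.IsNilpotent G] (K : Subgroup G) : K.FG := by
  obtain ⟨n, hn⟩ := Subgroup.nilpotent_iff_lowerCentralSeries.1 ‹Group.IsNilpotent G›
  exact fg_of_lowerCentralSeries_eq_bot n hn K

theorem finite_additive_center [Group.FG G] [Group.IsNilpotent G] :
    Module.Finite ℤ (Additive (center G)) :=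
  have : Group.FG (center G) := (Group.fg_iff_subgroup_fg _).2 (fg_of_isNilpotent _)
  Module.Finite.iff_addGroup_fg.2 inferInstance

theorem free_additive_center [Module.Finite ℤ (Additive (center G))]
    (hG : ∀ g : G, g ≠ 1 → ¬ IsOfFinOrder g) : Module.Free ℤ (Additive (center G)) := by
  have : IsMulTorsionFree (center G) := IsMulTorsionFree.of_not_isOfFinOrder fun z hz h =>
    hG z (Subtype.coe_ne_coe.2 hz) (Submonoid.isOfFinOrder_coe.2 h)
  exact Module.free_of_finite_type_torsion_free'

end NilpotentGroup

section ElementaryGeneration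

open Matrix

variable {ι : Type*} [DecidableEq ι]

section ColumnReduction

variable {R : Type*} {t : Finset ι} {X : Set (ι → R)}

theorem piecewise_mem_of_update_add_mul_mem [Ring R]
    (hX : ∀ v ∈ X, ∀ i, ∀ j ∈ t, i ≠ j → ∀ r, Function.update v i (v i + r * v j) ∈ X)
    {j : ι} (hj : j ∈ t) {v : ι → R} (hv : v ∈ X) (hvj : v j = 1) (w : ι → R) {s : Finset ι}
    (hjs : j ∉ s) : s.piecewise w v ∈ X := by
  induction s using Finset.induction_on with
  | empty => rwa [Finset.piecewise_empty]
  | insert i s _ ih =>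
    rw [Finset.mem_insert, not_or] at hjs
    rw [Finset.piecewise_insert]
    convert hX _ (ih hjs.2) i j hj (Ne.symm hjs.1) (w i - s.piecewise w v i) using 2
    rw [Finset.piecewise_eq_of_notMem _ _ _ hjs.2, hvj, mul_one, add_sub_cancel]

theorem exists_mem_apply_eq_one [Ring R]
    (hX : ∀ v ∈ X, ∀ i, ∀ j ∈ t, i ≠ j → ∀ r, Function.update v i (v i + r * v j) ∈ X)
    {b c j : ι} (hb : b ∈ t) (hc : c ∈ t) (hcj : c ≠ j) {v : ι → R} (hv : v ∈ X)
    (hvb : IsUnit (v b)) : ∃ w ∈ X, w j = 1 := by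
  have move {v : ι → R} (hv : v ∈ X) {b : ι} (hb : b ∈ t) (hvb : IsUnit (v b)) {i : ι}
      (hib : i ≠ b) : ∃ w ∈ X, w i = 1 := by
    obtain ⟨u, hu⟩ := hvb.exists_left_inv
    refine ⟨_, hX v hv i b hb hib ((1 - v i) * u), ?_⟩
    rw [Function.update_self, mul_assoc, hu, mul_one, add_sub_cancel]
  by_cases hbj : b = j
  · obtain ⟨w, hw, hwc⟩ := move hv hb hvb (hbj ▸ hcj)
    exact move hw hc (hwc ▸ isUnit_one) hcj.symm
  · exact move hv hb hvb (Ne.symm hbj)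

/-- The Euclidean algorithm on the entries indexed by `t`: an entry which does not divide all the
others leaves a smaller nonzero remainder. -/
theorem exists_mem_isUnit_apply [EuclideanDomain R]
    (hX : ∀ v ∈ X, ∀ i, ∀ j ∈ t, i ≠ j → ∀ r, Function.update v i (v i + r * v j) ∈ X)
    {v : ι → R} (hv : v ∈ X) (hunimodular : ∀ d, (∀ b ∈ t, d ∣ v b) → IsUnit d) :
    ∃ w ∈ X, ∃ b ∈ t, IsUnit (w b) := by
  obtain ⟨b, hb, hvb⟩ : ∃ b ∈ t, v b ≠ 0 := by
    by_contra! hzero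
    exact not_isUnit_zero (hunimodular 0 fun b hb => zero_dvd_iff.2 (hzero b hb))
  induction hr : v b using (EuclideanDomain.r_wellFounded (R := R)).induction generalizing v b with
  | h r ih =>
    subst hr
    by_cases hdvd : ∀ c ∈ t, v b ∣ v c
    · exact ⟨v, hv, b, hb, hunimodular _ hdvd⟩
    push Not at hdvd
    obtain ⟨c, hc, hbc⟩ := hdvd
    have hcb : c ≠ b := by rintro rfl; exact hbc dvd_rfl
    have hmod : v c + -(v c / v b) * v b = v c % v b := by
      rw [EuclideanDomain.mod_eq_sub_mul_div]; ring
    have hw := hX v hv c b hb hcb (-(v c / v b))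
    set w := Function.update v c (v c + -(v c / v b) * v b) with hw_def
    have hwc : w c = v c % v b := by rw [hw_def, Function.update_self, hmod]
    have hwa {a : ι} (ha : a ≠ c) : w a = v a := Function.update_of_ne ha _ _
    refine ih (w c) ?_ hw (fun d hd => ?_) c hc ?_ rfl
    · exact hwc ▸ EuclideanDomain.mod_lt _ hvb
    · have hdb : d ∣ v b := hwa hcb.symm ▸ hd b hb
      refine hunimodular d fun a ha => ?_
      by_cases hac : a = c
      · rw [hac, ← EuclideanDomain.dvd_mod_iff hdb, ← hwc]
        exact hd c hc
      · exact hwa hac ▸ hd a ha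
    · rwa [hwc, Ne, EuclideanDomain.mod_eq_zero]

theorem single_mem_of_update_add_mul_mem [Finite ι] [EuclideanDomain R]
    (hX : ∀ v ∈ X, ∀ i, ∀ j ∈ t, i ≠ j → ∀ r, Function.update v i (v i + r * v j) ∈ X)
    {j : ι} (hj : j ∈ t) {v : ι → R} (hv : v ∈ X)
    (hunimodular : ∀ d, (∀ b ∈ t, d ∣ v b) → IsUnit d)
    (hone : v j = 1 ∨ ∃ c ∈ t, c ≠ j) : Pi.single j 1 ∈ X := by
  have := Fintype.ofFinite ι
  obtain ⟨w, hw, hwj⟩ : ∃ w ∈ X, w j = 1 := by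
    rcases hone with hvj | ⟨c, hc, hcj⟩
    · exact ⟨v, hv, hvj⟩
    · obtain ⟨w, hw, b, hb, hwb⟩ := exists_mem_isUnit_apply hX hv hunimodular
      exact exists_mem_apply_eq_one hX hb hc hcj hw hwb
  convert piecewise_mem_of_update_add_mul_mem hX hj hw hwj 0 (Finset.notMem_erase j Finset.univ)
  ext a
  by_cases haj : a = j
  · simp [haj, hwj]
  · simp [haj]

end ColumnReduction

variable [Fintype ι]

section CommRing

variable {R : Type*} [CommRing R]

theorem transvection_smul {i j : ι} (hij : i ≠ j) (r : R) (v : ι → R) :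
    Matrix.SpecialLinearGroup.transvection hij r • v = Function.update v i (v i + r * v j) := by
  rw [Matrix.SpecialLinearGroup.smul_def, Matrix.SpecialLinearGroup.transvection_coe]
  ext a
  rcases eq_or_ne a i with rfl | ha
  · simp [add_mulVec, single_mulVec]
  · simp [add_mulVec, single_mulVec, ha]

/-- The subgroup of `SL(ι, R)` generated by the elementary transvections, which is the image of the
Steinberg group. -/
def elementarySubgroup (ι R : Type*) [DecidableEq ι] [Fintype ι] [CommRing R] :
    Subgroup (SpecialLinearGroup ι R) :=
  Subgroup.closure
    {A | ∃ (i j : ι) (hij : i ≠ j) (r : R), A = Matrix.SpecialLinearGroup.transvection hij r}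

/-- The matrices in `SL(ι, R)` whose columns outside `t` are those of the identity matrix. They form
the stages of Gaussian elimination, which shrinks `t` one index at a time. -/
def standardOutside (R : Type*) [CommRing R] (t : Finset ι) : Subgroup (SpecialLinearGroup ι R) :=
  fixingSubgroup _ ((fun i => (Pi.single i 1 : ι → R)) '' (↑t)ᶜ)

variable {t : Finset ι} {A : SpecialLinearGroup ι R}

theorem mem_standardOutside_iff :
    A ∈ standardOutside R t ↔ ∀ i ∉ t, A • (Pi.single i 1 : ι → R) = Pi.single i 1 := by
  simp [standardOutside, mem_fixingSubgroup_iff]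

theorem smul_single_one_apply (A : SpecialLinearGroup ι R) (i j : ι) :
    (A • (Pi.single j 1 : ι → R)) i = A i j := by
  rw [Matrix.SpecialLinearGroup.smul_def, smul_eq_mulVec, mulVec_single_one, col_apply]

theorem coe_apply_of_mem_standardOutside (hA : A ∈ standardOutside R t) {i : ι} (hi : i ∉ t)
    (a : ι) : A a i = (1 : Matrix ι ι R) a i := by
  rw [← smul_single_one_apply, mem_standardOutside_iff.1 hA i hi, one_eq_pi_single, Pi.single_comm]

theorem transvection_mem_inf_standardOutside {i j : ι} (hij : i ≠ j) (hj : j ∈ t) (r : R) :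
    Matrix.SpecialLinearGroup.transvection hij r ∈
      elementarySubgroup ι R ⊓ standardOutside R t := by
  refine ⟨Subgroup.subset_closure ⟨i, j, hij, r, rfl⟩, mem_standardOutside_iff.2 fun l hl => ?_⟩
  rw [transvection_smul, Pi.single_eq_of_ne (ne_of_mem_of_not_mem hj hl), mul_zero, add_zero,
    Function.update_eq_self]

theorem isUnit_of_forall_dvd_of_mem_standardOutside (hA : A ∈ standardOutside R t) {j : ι}
    (hj : j ∈ t) {d : R} (hd : ∀ b ∈ t, d ∣ A b j) : IsUnit d := by
  have hinv : ∑ b, A⁻¹ j b * A b j = 1 := by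
    rw [← mul_apply, ← Matrix.SpecialLinearGroup.coe_mul, inv_mul_cancel,
      Matrix.SpecialLinearGroup.coe_one, one_apply_eq]
  refine isUnit_of_dvd_one (hinv ▸ Finset.dvd_sum fun b _ => ?_)
  by_cases hb : b ∈ t
  · exact (hd b hb).mul_left _
  · have hzero : A⁻¹ j b = 0 :=
      (coe_apply_of_mem_standardOutside (inv_mem hA) hb j).trans
        (one_apply_ne (ne_of_mem_of_not_mem hj hb))
    rw [hzero, zero_mul]
    exact dvd_zero d

theorem coe_apply_self_of_mem_standardOutside_singleton {j : ι}
    (hA : A ∈ standardOutside R {j}) : A j j = 1 := by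
  have hcol : (A : Matrix ι ι R) = (1 : Matrix ι ι R).updateCol j (fun a => A a j) := by
    ext a i
    rcases eq_or_ne i j with rfl | hi
    · rw [updateCol_self]
    · rw [updateCol_ne hi]
      exact coe_apply_of_mem_standardOutside hA (by simpa using hi) a
  have hdet := A.det_coe
  rwa [hcol, ← cramer_apply, cramer_one] at hdet

end CommRing

variable {R : Type*} [EuclideanDomain R]

theorem exists_smul_single_eq_single {t : Finset ι} {j : ι} (hj : j ∉ t)
    {A : SpecialLinearGroup ι R} (hA : A ∈ standardOutside R (insert j t)) :
    ∃ g ∈ elementarySubgroup ι R ⊓ standardOutside R (insert j t),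
      (g * A) • (Pi.single j 1 : ι → R) = Pi.single j 1 := by
  let N := elementarySubgroup ι R ⊓ standardOutside R (insert j t)
  let X : Set (ι → R) := {w | ∃ g ∈ N, (g * A) • (Pi.single j 1 : ι → R) = w}
  refine single_mem_of_update_add_mul_mem (X := X) (t := insert j t) ?_ (Finset.mem_insert_self j t)
    (v := A • Pi.single j 1) ⟨1, one_mem N, by rw [one_mul]⟩ (fun d hd => ?_) ?_
  · rintro _ ⟨g, hg, rfl⟩ i l hl hil r
    refine ⟨Matrix.SpecialLinearGroup.transvection hil r * g,
      mul_mem (transvection_mem_inf_standardOutside hil hl r) hg, ?_⟩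
    rw [mul_assoc, mul_smul, transvection_smul]
  · simp only [smul_single_one_apply] at hd
    exact isUnit_of_forall_dvd_of_mem_standardOutside hA (Finset.mem_insert_self j t) hd
  · rcases t.eq_empty_or_nonempty with rfl | ⟨c, hc⟩
    · exact .inl ((smul_single_one_apply A j j).trans
        (coe_apply_self_of_mem_standardOutside_singleton hA))
    · exact .inr ⟨c, Finset.mem_insert_of_mem hc, ne_of_mem_of_not_mem hc hj⟩

theorem elementarySubgroup_eq_top : elementarySubgroup ι R = ⊤ := by
  suffices h : ∀ t : Finset ι, standardOutside R t ≤ elementarySubgroup ι R from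
    eq_top_iff.2 fun A _ => h Finset.univ (mem_standardOutside_iff.2 (by simp))
  intro t
  induction t using Finset.induction_on with
  | empty =>
    intro A hA
    have hA_one : A = 1 :=
      Matrix.SpecialLinearGroup.ext A 1 fun a i =>
        coe_apply_of_mem_standardOutside hA (Finset.notMem_empty i) a
    exact hA_one ▸ one_mem _
  | insert j t hj ih =>
    intro A hA
    obtain ⟨g, ⟨hg, hgt⟩, hgA⟩ := exists_smul_single_eq_single hj hA
    refine (Subgroup.mul_mem_cancel_left _ hg).1 (ih (mem_standardOutside_iff.2 fun i hi => ?_))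
    rcases eq_or_ne i j with rfl | hij
    · exact hgA
    · exact mem_standardOutside_iff.1 (mul_mem hgt hA) i (by simp [hij, hi])

end ElementaryGeneration

section OuterAutomorphisms

open Subgroup Module CategoryTheory.Limits
open scoped IsMulCommutative

variable {G : Type u} [Group G]

/-- The homomorphism `Aut(G) → Aut(G / Z(G))`, used to compare outer automorphisms along the upper
central series. -/
def autQuotientCenter (G : Type u) [Group G] : MulAut G →* MulAut (G ⧸ center G) where
  toFun φ := QuotientGroup.congr (center G) (center G) φ
    (characteristic_iff_map_eq.1 inferInstance φ)
  map_one' := by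
    ext q
    obtain ⟨g, rfl⟩ := QuotientGroup.mk_surjective q
    rfl
  map_mul' φ ψ := by
    ext q
    obtain ⟨g, rfl⟩ := QuotientGroup.mk_surjective q
    rfl

@[simp]
theorem autQuotientCenter_mk (φ : MulAut G) (g : G) :
    autQuotientCenter G φ (g : G ⧸ center G) = (φ g : G ⧸ center G) := rfl

theorem autQuotientCenter_conj (g : G) :
    autQuotientCenter G (MulAut.conj g) = MulAut.conj (g : G ⧸ center G) := by
  ext q
  obtain ⟨x, rfl⟩ := QuotientGroup.mk_surjective q
  rfl

theorem characteristic_center_conj (g : G) :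
    MulAut.characteristic (center G) (MulAut.conj g) = 1 := by
  ext z
  change g * z * g⁻¹ = z
  rw [mem_center_iff.1 z.2 g, mul_inv_cancel_right]

/-- The homomorphism `Out(G) → Out(G / Z(G))`. -/
def outerAutQuotientCenter (G : Type u) [Group G] : OuterAut G →* OuterAut (G ⧸ center G) :=
  QuotientGroup.map _ _ (autQuotientCenter G) <| by
    rintro _ ⟨g, rfl⟩
    exact ⟨g, (autQuotientCenter_conj g).symm⟩

/-- The homomorphism `Out(G) → Aut(Z(G))`, well defined because inner automorphisms fix the
center. -/
def outerAutCenter (G : Type u) [Group G] : OuterAut G →* MulAut (center G) :=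
  QuotientGroup.lift _ (MulAut.characteristic (center G)) <| by
    rintro _ ⟨g, rfl⟩
    exact characteristic_center_conj g

theorem exists_mulAut_mk_eq_of_outerAut_eq_one {o : OuterAut G}
    (hquot : outerAutQuotientCenter G o = 1) (hcenter : outerAutCenter G o = 1) :
    ∃ φ : MulAut G, (φ : OuterAut G) = o ∧ (∀ g, ∃ z ∈ center G, φ g = g * z) ∧
      ∀ z ∈ center G, φ z = z := by
  obtain ⟨ψ, rfl⟩ := QuotientGroup.mk_surjective o
  obtain ⟨q, hq⟩ := (QuotientGroup.eq_one_iff (N := innerAut (G ⧸ center G)) _).1 hquot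
  obtain ⟨x, rfl⟩ := QuotientGroup.mk_surjective q
  rw [← autQuotientCenter_conj] at hq
  refine ⟨(MulAut.conj x)⁻¹ * ψ, ?_, fun g => ⟨g⁻¹ * ((MulAut.conj x)⁻¹ * ψ) g, ?_, by simp⟩,
    fun z hz => ?_⟩
  · have conj_eq_one : (MulAut.conj x : OuterAut G) = 1 := (QuotientGroup.eq_one_iff _).2 ⟨x, rfl⟩
    rw [QuotientGroup.mk_mul, QuotientGroup.mk_inv, conj_eq_one, inv_one, one_mul]
  · rw [← QuotientGroup.eq, ← autQuotientCenter_mk, map_mul, map_inv, hq, inv_mul_cancel]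
    rfl
  · have restrict_eq_one : MulAut.characteristic (center G) ((MulAut.conj x)⁻¹ * ψ) = 1 := by
      rw [map_mul, map_inv, characteristic_center_conj, inv_one, one_mul]
      exact hcenter
    exact congrArg Subtype.val (DFunLike.congr_fun restrict_eq_one ⟨z, hz⟩)

/-- The kernel of `Out(G) → Out(G / Z(G)) × Aut(Z(G))` is abelian: it is represented by the
automorphisms `g ↦ g * z g` with `z` a homomorphism `G / Z(G) → Z(G)`. -/
theorem commute_of_outerAut_eq_one {o p : OuterAut G}
    (ho_quot : outerAutQuotientCenter G o = 1) (ho_center : outerAutCenter G o = 1)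
    (hp_quot : outerAutQuotientCenter G p = 1) (hp_center : outerAutCenter G p = 1) :
    Commute o p := by
  obtain ⟨φ, rfl, hφ, hφz⟩ := exists_mulAut_mk_eq_of_outerAut_eq_one ho_quot ho_center
  obtain ⟨ψ, rfl, hψ, hψz⟩ := exists_mulAut_mk_eq_of_outerAut_eq_one hp_quot hp_center
  suffices Commute φ ψ from this.map (QuotientGroup.mk' (innerAut G))
  ext g
  obtain ⟨y, hy, hφg⟩ := hφ g
  obtain ⟨z, hz, hψg⟩ := hψ g
  rw [MulAut.mul_apply, MulAut.mul_apply, hψg, hφg, map_mul, map_mul, hφg, hψg, hφz z hz,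
    hψz y hy, mul_assoc, mul_assoc, mem_center_iff.1 hz y]

instance subsingleton_outerAut [Subsingleton G] : Subsingleton (OuterAut G) :=
  have : Subsingleton (MulAut G) := ⟨fun _ _ => MulEquiv.ext fun _ => Subsingleton.elim _ _⟩
  QuotientGroup.mk_surjective.subsingleton

theorem SteinbergGroup.hom_outerAut_eq_one {n : ℕ} {R : Type v} [Ring R] (hn : 3 ≤ n)
    [Module.Free ℤ (Additive (center G))] [Module.Finite ℤ (Additive (center G))]
    (hcenter : finrank ℤ (Additive (center G)) < n)
    (hquot : ∀ f : SteinbergGroup n R →* OuterAut (G ⧸ center G), f = 1)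
    (f : SteinbergGroup n R →* OuterAut G) : f = 1 := by
  have quotient_eq_one (a) : outerAutQuotientCenter G (f a) = 1 :=
    DFunLike.congr_fun (hquot ((outerAutQuotientCenter G).comp f)) a
  have center_eq_one (a) : outerAutCenter G (f a) = 1 :=
    DFunLike.congr_fun (hom_mulAut_eq_one hn hcenter ((outerAutCenter G).comp f)) a
  exact hom_eq_one_of_commute hn fun a b => commute_of_outerAut_eq_one
    (quotient_eq_one a) (center_eq_one a) (quotient_eq_one b) (center_eq_one b)

/-- The degree `h` is the Hirsch length of `G`. -/
theorem exists_regularExtNontrivial_and_hom_outerAut_eq_one (K : Type u) [CommRing K]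
    [Nontrivial K] (G : Type u) [Group G] [Group.IsNilpotent G] :
    Group.FG G → (∀ g : G, g ≠ 1 → ¬ IsOfFinOrder g) →
    ∃ h : ℕ, RegularExtNontrivial K G h ∧ ∀ n, 3 ≤ n → h < n →
      ∀ (R : Type v) [Ring R] (f : SteinbergGroup n R →* OuterAut G), f = 1 := by
  apply @Group.nilpotent_center_quotient_ind _ G _ _ <;> clear! G
  · intro G _ _ _ _
    exact ⟨0, .zero_of_subsingleton, fun _ _ _ _ _ _ => MonoidHom.ext fun _ =>
      Subsingleton.elim _ _⟩
  · intro G _ _ ih _ hG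
    rcases subsingleton_or_nontrivial G with _ | _
    · exact ⟨0, .zero_of_subsingleton, fun _ _ _ _ _ _ => MonoidHom.ext fun _ =>
        Subsingleton.elim _ _⟩
    obtain ⟨h, hext, hhom⟩ := ih inferInstance (not_isOfFinOrder_quotient_center hG)
    have := finite_additive_center (G := G)
    have := free_additive_center hG
    have : Nontrivial (center G) :=
      (nontrivial_iff_ne_bot _).2 (Group.IsNilpotent.center_ne_bot G)
    have : Nonempty (Fin (finrank ℤ (Additive (center G)))) := ⟨⟨0, finrank_pos⟩⟩
    have hext' := hext.of_quotient_center (finBasis ℤ (Additive (center G)))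
    rw [Fintype.card_fin] at hext'
    exact ⟨_, hext', fun n hn hlt R _ =>
      SteinbergGroup.hom_outerAut_eq_one hn (by omega) (hhom n hn (by omega) R)⟩

end OuterAutomorphisms

section SteinbergToSpecialLinear

open Matrix SpecialLinearGroup

variable {ι : Type*} [DecidableEq ι] [Fintype ι] {n : ℕ} {R : Type v} [CommRing R]

theorem transvection_mul_transvection {i j l : ι} (hij : i ≠ j) (hjl : j ≠ l) (hil : i ≠ l)
    (r s : R) :
    transvection hij r * transvection hjl s =
      transvection hil (r * s) * transvection hjl s * transvection hij r :=
  Subtype.ext <| by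
    simp [transvection_coe, mul_add, add_mul, hjl.symm, hil.symm]
    abel

theorem commute_transvection {i j p q : ι} (hij : i ≠ j) (hpq : p ≠ q) (hjp : j ≠ p)
    (hiq : i ≠ q) (r s : R) : Commute (transvection hij r) (transvection hpq s) :=
  Subtype.ext <| by
    simp [transvection_coe, mul_add, add_mul, hjp, hiq.symm]
    abel

/-- The homomorphism `St_n(R) → SL_n(R)` sending `x_{ij}(r)` to an elementary transvection, through
which homomorphisms out of `SL_n(R)` pull back to the Steinberg group. -/
def SteinbergGroup.toSpecialLinearGroup (n : ℕ) (R : Type v) [CommRing R] :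
    SteinbergGroup n R →* SpecialLinearGroup (Fin n) R :=
  PresentedGroup.toGroup (f := fun p => SpecialLinearGroup.transvection p.1.2 p.2) <| by
    rintro _ (⟨i, j, hij, r, s⟩ | ⟨i, j, l, hij, hjl, hil, r, s⟩ |
      ⟨i, j, p, q, hij, hpq, hjp, hiq, r, s⟩) <;>
    simp only [map_mul, map_inv, FreeGroup.lift_apply_of, mul_inv_eq_iff_eq_mul, one_mul]
    · exact (transvection_add hij r s).symm
    · exact transvection_mul_transvection hij hjl hil r s
    · exact commute_transvection hij hpq hjp hiq r s

theorem SteinbergGroup.toSpecialLinearGroup_of {i j : Fin n} (hij : i ≠ j) (r : R) :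
    toSpecialLinearGroup n R (PresentedGroup.of (⟨(i, j), hij⟩, r)) =
      SpecialLinearGroup.transvection hij r :=
  PresentedGroup.toGroup.of _

theorem hom_specialLinearGroup_eq_one {R : Type v} [EuclideanDomain R] {H : Type*} [Group H]
    (hH : ∀ f : SteinbergGroup n R →* H, f = 1) (f : SpecialLinearGroup (Fin n) R →* H) :
    f = 1 := by
  rw [← MonoidHom.ker_eq_top_iff, eq_top_iff, ← elementarySubgroup_eq_top, elementarySubgroup,
    Subgroup.closure_le]
  rintro _ ⟨i, j, hij, r, rfl⟩
  rw [SetLike.mem_coe, MonoidHom.mem_ker, ← SteinbergGroup.toSpecialLinearGroup_of]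
  exact DFunLike.congr_fun (hH (f.comp (SteinbergGroup.toSpecialLinearGroup n R))) _

end SteinbergToSpecialLinear

theorem mainTheorem7_general (K : Type u) [CommRing K] [Nontrivial K] (G : Type u) [Group G]
    [Group.FG G] [Group.IsNilpotent G] (hG : ∀ g : G, g ≠ 1 → ¬ IsOfFinOrder g) (n : ℕ) (hn : 3 ≤ n)
    (hK : ∀ i, n ≤ i → CategoryTheory.Limits.IsZero
      (groupCohomology (Rep.free K G PUnit.{u + 1}) i)) :
    (∀ (R : Type v) [Ring R] (f : SteinbergGroup n R →* OuterAut G), f = 1) ∧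
      ∀ (R : Type v) [EuclideanDomain R]
        (f : Matrix.SpecialLinearGroup (Fin n) R →* OuterAut G), f = 1 := by
  obtain ⟨h, hext, hhom⟩ :=
    exists_regularExtNontrivial_and_hom_outerAut_eq_one K G inferInstance hG
  have hSt := hhom n hn (hext.lt_of_isZero_groupCohomology (by omega) hK)
  exact ⟨hSt, fun R _ => hom_specialLinearGroup_eq_one (hSt R)⟩

theorem mainTheorem7 (G : Type u) [Group G] [Group.FG G] [Group.IsNilpotent G]
    (hG : ∀ g : G, g ≠ 1 → ¬ IsOfFinOrder g)
    (k n : ℕ) (hn : 3 ≤ n) (hk : HasCohomologicalDimension G k) (hkn : k < n) :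
    (∀ f : SteinbergGroup n ℤ →* OuterAut G, f = 1) ∧
      (∀ f : Matrix.SpecialLinearGroup (Fin n) ℤ →* OuterAut G, f = 1) := by
  have hmain := mainTheorem7_general (ULift.{u} ℤ) G hG n hn fun i hi => hk.1 _ i (hkn.trans_le hi)
  exact ⟨hmain.1 ℤ, hmain.2 ℤ⟩
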